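/- Let $n\ge 0$ and let $\mu\subseteq\lambda$ be partitions, with (skew) Young diagrams drawn in the usual way; $\ell(\cdot)$ denotes the number of parts. The skew Schur polynomial $s_{\lambda/\mu}(x_1,\ldots,x_n)$ is the sum of $x^{T}=\prod_{b}x_{T(b)}$ over all semistandard tableaux $T$ of shape $\lambda/\mu$ with entries in $\{1,\ldots,n\}$, and $s_\nu:=s_{\nu/\emptyset}$. It is called multiplicity-free if in the expansion $$s_{\lambda/\mu}(x_1,\ldots,x_n)=\sum_{\nu,\ \ell(\nu)\le n}c_\nu\, s_\nu(x_1,\ldots,x_n)$$ all coefficients $c_\nu$ lie in $\{0,1\}$. Let $\rho=\rho(\lambda/\mu)$ be the largest number of boxes in a column of $\lambda/\mu$. The skew partition $\lambda/\mu$ is basic if none of the rows $1,\ldots,\ell(\lambda)$ and none of the columns $1,\ldots,\lambda_1$ of its diagram is empty. It is $m$-sharp if every column has fewer than $m$ boxes. If $\lambda/\mu$ is basic, it is tight if $\tau(\lambda/\mu)=\sigma(\lambda/\mu)=0$, where $\tau=\sigma=0$ if $\mu=\emptyset$ or $\lambda$ is a rectangle, and otherwise $\tau=l_1-\min(l_1,\ell(\mu))$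 and $\sigma=d-\min(\mu_1,d)$, with $l_1$ the multiplicity of the largest part of $\lambda$ and $d$ the smallest nonzero part of $\lambda$. A rectangle is a partition with exactly one distinct nonzero part. Let $\lambda^\vee$ be the complement of $\lambda$ in the rectangle with $\ell(\lambda)$ rows of length $\lambda_1$, rotated by $180$ degrees. **Theorem.** Suppose that $\lambda/\mu$ is basic, $n$-sharp and tight, and that each of $\lambda^\vee$ and $\mu$ is nonempty and not a rectangle (that is, each has at least two distinct nonzero parts). Then $s_{\lambda/\mu}(x_1,\ldots,x_n)$ is not multiplicity-free. Moreover $\mathsf m(\lambda/\mu)=\rho+1$, where $\mathsf m(\lambda/\mu)$ is the smallest integer $m$ such that $\lambda/\mu$ is $m$-sharp and $s_{\lambda/\mu}(x_1,\ldots,x_m)$ is not multiplicity-free. -/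

import Mathlib

noncomputable section

namespace SkewSchur

/-!
Partitions are Young diagrams (`YoungDiagram`): `lam.rowLen i` is the part `λ_{i+1}` (and `0` from
`i = ℓ(λ)` on), `lam.colLen 0` is the length `ℓ(λ)`, and `⊥` is the empty partition. Rows, columns
and the entries of fillings are indexed from `0`.
A skew partition `λ / μ` is a pair with `mu ≤ lam`.
-/

/-- The boxes `(row, column)` of the skew diagram `λ / μ`. -/
def skewCells (lam mu : YoungDiagram) : Finset (ℕ × ℕ) := lam.cells \ mu.cells

/-- A filling of `λ / μ` with `n` possible entries is a semistandard tableau if it increases weakly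
along the rows (left to right) and strictly down the columns. -/
def IsSemistandard {lam mu : YoungDiagram} {n : ℕ} (T : skewCells lam mu → Fin n) : Prop :=
  (∀ a b : skewCells lam mu, a.1.1 = b.1.1 → a.1.2 ≤ b.1.2 → T a ≤ T b) ∧
  (∀ a b : skewCells lam mu, a.1.2 = b.1.2 → a.1.1 < b.1.1 → T a < T b)

open Classical in
/-- The skew Schur polynomial `s_{λ/μ}(x_1, …, x_n)`: the sum of the content monomials of all
semistandard tableaux of shape `λ / μ` with `n` possible entries. -/
def skewSchurPoly (n : ℕ) (lam mu : YoungDiagram) : MvPolynomial (Fin n) ℤ :=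
  ∑ T : skewCells lam mu → Fin n with IsSemistandard T, ∏ a, MvPolynomial.X (T a)

/-- The Schur polynomial `s_ν(x_1, …, x_n) = s_{ν/∅}(x_1, …, x_n)`. -/
def schurPoly (n : ℕ) (nu : YoungDiagram) : MvPolynomial (Fin n) ℤ := skewSchurPoly n nu ⊥

/-- `f = ∑ c_ν s_ν(x_1, …, x_n)`, a finite sum over partitions `ν` with `ℓ(ν) ≤ n`. These `s_ν` are
a `ℤ`-basis of the symmetric polynomials, so that `f` determines `c`. -/
def IsSchurExpansion (n : ℕ) (f : MvPolynomial (Fin n) ℤ) (c : YoungDiagram →₀ ℤ) : Prop :=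
  (∀ nu, c nu ≠ 0 → nu.colLen 0 ≤ n) ∧ f = c.sum fun nu a => a • schurPoly n nu

/-- `s_{λ/μ}(x_1, …, x_n)` is multiplicity-free: the coefficients of its expansion into Schur
polynomials are all `0` or `1`. -/
def IsMultiplicityFree (n : ℕ) (lam mu : YoungDiagram) : Prop :=
  ∃ c : YoungDiagram →₀ ℤ, IsSchurExpansion n (skewSchurPoly n lam mu) c ∧
    ∀ nu, c nu = 0 ∨ c nu = 1

/-- No row and no column of the diagram `λ / μ` is empty. -/
def IsBasic (lam mu : YoungDiagram) : Prop :=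
  (∀ i < lam.colLen 0, ∃ j, (i, j) ∈ skewCells lam mu) ∧
  (∀ j < lam.rowLen 0, ∃ i, (i, j) ∈ skewCells lam mu)

/-- The number of boxes of `λ / μ` in column `k`. -/
def colSize (lam mu : YoungDiagram) (k : ℕ) : ℕ := {a ∈ skewCells lam mu | a.2 = k}.card

/-- `ρ(λ / μ)`, the largest number of boxes in a column. -/
def rho (lam mu : YoungDiagram) : ℕ := (Finset.range (lam.rowLen 0)).sup (colSize lam mu)

/-- `λ / μ` is `n`-sharp: every column has fewer than `n` boxes. -/
def IsSharp (n : ℕ) (lam mu : YoungDiagram) : Prop := ∀ k, colSize lam mu k < n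

/-- `np(λ)`, the number of distinct (nonzero) parts of `λ`. -/
def numParts (lam : YoungDiagram) : ℕ := lam.rowLens.toFinset.card

/-- A rectangle is a partition with exactly one distinct part; `∅` is not a rectangle. -/
def IsRectangle (lam : YoungDiagram) : Prop := numParts lam = 1

/-- The multiplicity `l_1` of the largest part `λ_1` in `λ`. -/
def firstMult (lam : YoungDiagram) : ℕ := lam.rowLens.count (lam.rowLen 0)

/-- The smallest (nonzero) part of a nonempty `λ`. -/
def lastPart (lam : YoungDiagram) : ℕ := lam.rowLen (lam.colLen 0 - 1)

open Classical in
/-- `τ(λ / μ)`. -/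
def tau (lam mu : YoungDiagram) : ℕ :=
  if mu = ⊥ ∨ IsRectangle lam then 0 else firstMult lam - min (firstMult lam) (mu.colLen 0)

open Classical in
/-- `σ(λ / μ)`. -/
def sigma (lam mu : YoungDiagram) : ℕ :=
  if mu = ⊥ ∨ IsRectangle lam then 0 else lastPart lam - min (mu.rowLen 0) (lastPart lam)

/-- A basic skew partition `λ / μ` is tight if `τ(λ / μ) = σ(λ / μ) = 0`. -/
def IsTight (lam mu : YoungDiagram) : Prop :=
  IsBasic lam mu ∧ tau lam mu = 0 ∧ sigma lam mu = 0

/-- The `(a^b)`-complement of a partition `λ ⊆ (a^b)`: the complement of `λ` in the rectangle with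
`b` rows and `a` columns, rotated by 180 degrees. -/
def compl (lam : YoungDiagram) (a b : ℕ) : YoungDiagram where
  cells := {x ∈ Finset.range b ×ˢ Finset.range a | (b - 1 - x.1, a - 1 - x.2) ∉ lam}
  isLowerSet := by
    rintro ⟨i, j⟩ ⟨i', j'⟩ hle h
    obtain ⟨hi, hj⟩ : i' ≤ i ∧ j' ≤ j := hle
    simp only [Finset.coe_filter, Finset.mem_product, Finset.mem_range, Set.mem_ofPred_eq] at h ⊢
    refine ⟨⟨by omega, by omega⟩, fun hm => h.2 ?_⟩
    exact lam.up_left_mem (by omega) (by omega) hm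

/-- `λ^∨`, the complement of `λ` in the fixed rectangle `(λ_1^{ℓ(λ)})`. -/
def dual (lam : YoungDiagram) : YoungDiagram := compl lam (lam.rowLen 0) (lam.colLen 0)

end SkewSchur

end

noncomputable section

namespace SkewSchur

open Finset

/-! Being `m`-sharp means `ρ < m`, so everything reduces to the failure of multiplicity-freeness for
every `n > ρ`.

Multiplication by the alternant of the staircase turns `s_{λ/μ}` into a sum of alternants over the
tableaux with a lattice reading word; the other tableaux cancel in pairs under a Bender-Knuth
involution restricted to the columns left of the first failure (`alternant_mul_skewSchurPoly`).
Hence two different lattice tableaux with the same content suffice (`not_isMultiplicityFree_of_ne`).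

These are built by columns: fill the columns independently, then sort the rows. The lattice
condition becomes a sum of column contributions (`not_isMultiplicityFree_of_columns`). A maximal run
of consecutive entries contributes `+1` at its end and, unless it starts with `0`, `-1` at its
start. A start is paid for by a run of another column that ends with the preceding entry, no lower
down. Columns filled with `0, 1, 2, …` never cost anything, so all but two columns are filled this
way; the two fillings differ by exchanging a pair of entries between those two columns.

Three configurations of columns leave room for such an exchange: `not_isMultiplicityFree_of_steps`,
`not_isMultiplicityFree_of_straight_rotated` and `not_isMultiplicityFree_of_rotated_straight`. One
of them always occurs: take the first column with both ends strictly above those of column `0`, and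
compare its bottom with that of the last column and its top with the top row. -/

/-- A Gelfand-Tsetlin pattern of shape `lam / mu`: `g k i` is the length of row `i` of `mu` together
with the boxes in row `i` that hold an entry less than `k`. -/
structure IsRowPattern (n : ℕ) (lam mu : YoungDiagram) (g : ℕ → ℕ → ℕ) : Prop where
  zero : ∀ i, g 0 i = mu.rowLen i
  top : ∀ k, n ≤ k → ∀ i, g k i = lam.rowLen i
  mono : ∀ k i, g k i ≤ g (k + 1) i
  interlace : ∀ k i, g (k + 1) (i + 1) ≤ g k i

theorem lt_card_iff_mem {s : Finset ℕ} (h : ∀ a ∈ s, ∀ b ≤ a, b ∈ s) (c : ℕ) :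
    c < #s ↔ c ∈ s := by
  constructor
  · intro hc
    by_contra hcs
    have : s ⊆ range c := fun a ha => by
      rw [mem_range]
      by_contra hac
      exact hcs (h a ha c (by omega))
    have := card_le_card this
    rw [card_range] at this
    omega
  · intro hc
    have : range (c + 1) ⊆ s := fun a ha => h c hc a (by rw [mem_range] at ha; omega)
    have := card_le_card this
    rw [card_range] at this
    omega

theorem mem_skewCells {lam mu : YoungDiagram} {i c : ℕ} :
    (i, c) ∈ skewCells lam mu ↔ mu.rowLen i ≤ c ∧ c < lam.rowLen i := by
  simp only [skewCells, mem_sdiff, YoungDiagram.mem_cells, YoungDiagram.mem_iff_lt_rowLen]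
  omega

theorem skewCells_bounds {lam mu : YoungDiagram} (a : skewCells lam mu) :
    mu.rowLen a.1.1 ≤ a.1.2 ∧ a.1.2 < lam.rowLen a.1.1 := mem_skewCells.1 a.2

theorem rowLen_mono {lam mu : YoungDiagram} (hsub : mu ≤ lam) (i : ℕ) :
    mu.rowLen i ≤ lam.rowLen i := by
  by_contra! h
  have h1 : (i, lam.rowLen i) ∈ mu := YoungDiagram.mem_iff_lt_rowLen.2 h
  have h2 : (i, lam.rowLen i) ∈ lam := hsub h1
  exact lt_irrefl _ (YoungDiagram.mem_iff_lt_rowLen.1 h2)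

theorem rowLen_eq_zero {lam : YoungDiagram} {i : ℕ} (h : lam.colLen 0 ≤ i) : lam.rowLen i = 0 := by
  by_contra hne
  have h1 : (i, 0) ∈ lam := YoungDiagram.mem_iff_lt_rowLen.2 (by omega)
  rw [YoungDiagram.mem_iff_lt_colLen] at h1
  omega

/-! ### Tableaux as Gelfand-Tsetlin patterns -/

section Pattern

variable {n : ℕ} {lam mu : YoungDiagram}

open Classical in
/-- The columns that row `i` of `mu` and the entries less than `k` in row `i` of `T` occupy. -/
def cellsBelow (T : skewCells lam mu → Fin n) (k i : ℕ) : Finset ℕ :=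
  {c ∈ range (lam.rowLen i) | c < mu.rowLen i ∨ ∃ h : (i, c) ∈ skewCells lam mu, (T ⟨(i, c), h⟩ : ℕ) < k}

/-- The Gelfand-Tsetlin pattern of a tableau. -/
def rowPattern (T : skewCells lam mu → Fin n) (k i : ℕ) : ℕ := #(cellsBelow T k i)

theorem lt_rowPattern_iff (hsub : mu ≤ lam) {T : skewCells lam mu → Fin n} (hT : IsSemistandard T)
    (k i c : ℕ) : c < rowPattern T k i ↔
      c < mu.rowLen i ∨ ∃ h : (i, c) ∈ skewCells lam mu, (T ⟨(i, c), h⟩ : ℕ) < k := by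
  have hmem : ∀ c, c ∈ cellsBelow T k i ↔
      c < mu.rowLen i ∨ ∃ h : (i, c) ∈ skewCells lam mu, (T ⟨(i, c), h⟩ : ℕ) < k := by
    intro c
    rw [cellsBelow, mem_filter, mem_range, and_iff_right_iff_imp]
    rintro (h | ⟨h, -⟩)
    · exact h.trans_le (rowLen_mono hsub i)
    · exact (mem_skewCells.1 h).2
  rw [rowPattern, lt_card_iff_mem, hmem]
  intro a ha b hb
  rw [hmem] at ha ⊢
  by_cases hbm : b < mu.rowLen i
  · exact .inl hbm
  · obtain ha | ⟨ha, hlt⟩ := ha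
    · omega
    · have hb' : (i, b) ∈ skewCells lam mu := by
        rw [mem_skewCells] at ha ⊢
        omega
      have := hT.1 ⟨(i, b), hb'⟩ ⟨(i, a), ha⟩ rfl hb
      exact .inr ⟨hb', lt_of_le_of_lt this hlt⟩

theorem lt_rowPattern_iff_of_mem (hsub : mu ≤ lam) {T : skewCells lam mu → Fin n}
    (hT : IsSemistandard T) (k : ℕ) (a : skewCells lam mu) :
    a.1.2 < rowPattern T k a.1.1 ↔ (T a : ℕ) < k := by
  rw [lt_rowPattern_iff hsub hT]
  have := (skewCells_bounds a).1
  constructor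
  · rintro (h | ⟨_, h⟩)
    · omega
    · exact h
  · intro h
    exact .inr ⟨a.2, h⟩

theorem isRowPattern_rowPattern (hsub : mu ≤ lam) {T : skewCells lam mu → Fin n}
    (hT : IsSemistandard T) : IsRowPattern n lam mu (rowPattern T) where
  zero i := by
    refine eq_of_forall_lt_iff fun c => ?_
    rw [lt_rowPattern_iff hsub hT]
    simp
  top k hk i := by
    refine eq_of_forall_lt_iff fun c => ?_
    rw [lt_rowPattern_iff hsub hT]
    constructor
    · rintro (h | ⟨h, -⟩)
      · exact h.trans_le (rowLen_mono hsub i)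
      · exact (mem_skewCells.1 h).2
    · intro h
      by_cases hc : c < mu.rowLen i
      · exact .inl hc
      · exact .inr ⟨mem_skewCells.2 ⟨by omega, h⟩, lt_of_lt_of_le (T _).2 hk⟩
  mono k i := by
    refine le_of_forall_lt fun c => ?_
    rw [lt_rowPattern_iff hsub hT, lt_rowPattern_iff hsub hT]
    rintro (h | ⟨h, h'⟩)
    · exact .inl h
    · exact .inr ⟨h, by omega⟩
  interlace k i := by
    refine le_of_forall_lt fun c => ?_
    rw [lt_rowPattern_iff hsub hT, lt_rowPattern_iff hsub hT]
    have hmu := mu.rowLen_anti i (i + 1) (by omega)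
    have hlam := lam.rowLen_anti i (i + 1) (by omega)
    rintro (h | ⟨h, h'⟩)
    · exact .inl (by omega)
    · by_cases hc : c < mu.rowLen i
      · exact .inl hc
      · have h1 := mem_skewCells.1 h
        have hm : (i, c) ∈ skewCells lam mu := mem_skewCells.2 ⟨by omega, by omega⟩
        have := hT.2 ⟨(i, c), hm⟩ ⟨(i + 1, c), h⟩ rfl (Nat.lt_succ_self i)
        rw [Fin.lt_def] at this
        exact .inr ⟨hm, by omega⟩

theorem rowPattern_injOn (hsub : mu ≤ lam) :
    Set.InjOn rowPattern {T : skewCells lam mu → Fin n | IsSemistandard T} := by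
  intro T hT T' hT' h
  funext a
  refine Fin.ext (eq_of_forall_gt_iff fun k => ?_)
  rw [← lt_rowPattern_iff_of_mem hsub hT, ← lt_rowPattern_iff_of_mem hsub hT', h]

theorem IsRowPattern.le_of_le {g : ℕ → ℕ → ℕ} (hg : IsRowPattern n lam mu g) (i : ℕ) {k l : ℕ}
    (h : k ≤ l) : g k i ≤ g l i :=
  monotone_nat_of_le_succ (f := fun k => g k i) (fun k => hg.mono k i) h

theorem IsRowPattern.anti {g : ℕ → ℕ → ℕ} (hg : IsRowPattern n lam mu g) (k : ℕ) {i j : ℕ}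
    (h : i ≤ j) : g k j ≤ g k i :=
  antitone_nat_of_succ_le (f := g k) (fun i => (hg.mono k _).trans (hg.interlace k i)) h

theorem IsRowPattern.le_rowLen {g : ℕ → ℕ → ℕ} (hg : IsRowPattern n lam mu g) (k i : ℕ) :
    g k i ≤ lam.rowLen i := by
  rw [← hg.top (max k n) (le_max_right _ _) i]
  exact hg.le_of_le i (le_max_left _ _)

/-- The box in row `i` and column `c` receives the least `k` with `c < g (k + 1) i`; interlacing
makes the columns strict. -/
theorem IsRowPattern.exists_rowPattern_eq (hsub : mu ≤ lam) {g : ℕ → ℕ → ℕ}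
    (hg : IsRowPattern n lam mu g) :
    ∃ T : skewCells lam mu → Fin n, IsSemistandard T ∧ rowPattern T = g := by
  have hpos : ∀ a : skewCells lam mu, 0 < n := fun a => by
    by_contra h
    have h1 := skewCells_bounds a
    have h2 := hg.top 0 (by omega) a.1.1
    have h3 := hg.zero a.1.1
    omega
  have hex : ∀ a : skewCells lam mu, ∃ k, a.1.2 < g (k + 1) a.1.1 := fun a =>
    ⟨n, by rw [hg.top _ (by omega)]; exact (skewCells_bounds a).2⟩
  have hlt : ∀ a, Nat.find (hex a) < n := fun a => by
    have h0 := hpos a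
    rw [Nat.find_lt_iff]
    refine ⟨n - 1, by omega, ?_⟩
    rw [Nat.sub_add_cancel (by omega), hg.top _ le_rfl]
    exact (skewCells_bounds a).2
  have hiff : ∀ (a : skewCells lam mu) k, Nat.find (hex a) < k ↔ a.1.2 < g k a.1.1 := by
    intro a k
    rw [Nat.find_lt_iff]
    constructor
    · rintro ⟨m, hm, h⟩
      exact h.trans_le (hg.le_of_le _ hm)
    · intro h
      cases k with
      | zero =>
        rw [hg.zero] at h
        have := (skewCells_bounds a).1
        omega
      | succ k => exact ⟨k, by omega, h⟩
  let T : skewCells lam mu → Fin n := fun a => ⟨Nat.find (hex a), hlt a⟩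
  have hT : IsSemistandard T := by
    refine ⟨fun a b h1 h2 => ?_, fun a b h1 h2 => ?_⟩
    · have := Nat.find_spec (hex b)
      refine Nat.find_le_iff _ _ |>.2 ⟨_, le_rfl, ?_⟩
      rw [h1]
      exact lt_of_le_of_lt h2 this
    · have h3 := Nat.find_spec (hex b)
      rw [Fin.lt_def]
      refine (hiff a _).2 ?_
      rw [h1]
      refine h3.trans_le ?_
      obtain ⟨m, hm⟩ := Nat.exists_eq_add_of_lt h2
      have h4 := hg.interlace (Nat.find (hex b)) (a.1.1 + m)
      rw [← hm] at h4
      exact h4.trans (hg.anti _ (by omega))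
  refine ⟨T, hT, ?_⟩
  funext k i
  refine eq_of_forall_lt_iff fun c => ?_
  rw [lt_rowPattern_iff hsub hT]
  constructor
  · rintro (h | ⟨h, h'⟩)
    · rw [← hg.zero] at h
      exact h.trans_le (hg.le_of_le _ (Nat.zero_le k))
    · exact (hiff ⟨(i, c), h⟩ k).1 h'
  · intro h
    by_cases hc : c < mu.rowLen i
    · exact .inl hc
    · have hm : (i, c) ∈ skewCells lam mu :=
        mem_skewCells.2 ⟨by omega, h.trans_le (hg.le_rowLen k i)⟩
      exact .inr ⟨hm, (hiff ⟨(i, c), hm⟩ k).2 h⟩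

end Pattern

open Classical in
/-- The finite set of Gelfand-Tsetlin patterns of shape `lam / mu` with `n` possible entries. -/
def rowPatterns (n : ℕ) (lam mu : YoungDiagram) : Finset (ℕ → ℕ → ℕ) :=
  ({T : skewCells lam mu → Fin n | IsSemistandard T} : Finset _).image rowPattern

open Classical in
theorem mem_rowPatterns {n : ℕ} {lam mu : YoungDiagram} (hsub : mu ≤ lam) {g : ℕ → ℕ → ℕ} :
    g ∈ rowPatterns n lam mu ↔ IsRowPattern n lam mu g := by
  rw [rowPatterns, mem_image]
  constructor
  · rintro ⟨T, hT, rfl⟩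
    exact isRowPattern_rowPattern hsub (by simpa using hT)
  · intro hg
    obtain ⟨T, hT, h⟩ := hg.exists_rowPattern_eq hsub
    exact ⟨T, by simpa using hT, h⟩

/-! ### Contents of patterns -/

/-- The sum of the first `L` row lengths of the `k`-th shape of a pattern. -/
def rowSum (L : ℕ) (g : ℕ → ℕ → ℕ) (k : ℕ) : ℕ := ∑ i ∈ range L, g k i

/-- The number of entries `k` in a tableau with pattern `g`. -/
def patternWeight (L n : ℕ) (g : ℕ → ℕ → ℕ) (k : Fin n) : ℕ := rowSum L g (k + 1) - rowSum L g k

theorem IsRowPattern.rowSum_le {n : ℕ} {lam mu : YoungDiagram} {g : ℕ → ℕ → ℕ}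
    (hg : IsRowPattern n lam mu g) (L k : ℕ) : rowSum L g k ≤ rowSum L g (k + 1) :=
  sum_le_sum fun i _ => hg.mono k i

theorem card_fiber_eq_patternWeight {n : ℕ} {lam mu : YoungDiagram} (hsub : mu ≤ lam)
    {T : skewCells lam mu → Fin n} (hT : IsSemistandard T) (k : Fin n) :
    #{a | T a = k} = patternWeight (lam.colLen 0) n (rowPattern T) k := by
  have hg := isRowPattern_rowPattern hsub hT
  have hmap : Set.MapsTo (fun a : skewCells lam mu => a.1.1)
      ({a | T a = k} : Finset (skewCells lam mu)) (range (lam.colLen 0)) := by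
    intro a _
    have h := (skewCells_bounds a).2
    by_contra hcon
    rw [coe_range, Set.mem_Iio, not_lt] at hcon
    rw [rowLen_eq_zero hcon] at h
    omega
  rw [card_eq_sum_card_fiberwise hmap, patternWeight, rowSum, rowSum]
  have hrow : ∀ i, #{a ∈ ({a | T a = k} : Finset (skewCells lam mu)) | a.1.1 = i} =
      rowPattern T (k + 1) i - rowPattern T k i := by
    intro i
    rw [← Nat.card_Ico]
    refine card_bij (fun a _ => a.1.2) ?_ ?_ ?_
    · intro a ha
      simp only [mem_filter, mem_univ, true_and] at ha
      obtain ⟨h1, rfl⟩ := ha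
      rw [mem_Ico, ← not_lt, lt_rowPattern_iff_of_mem hsub hT, lt_rowPattern_iff_of_mem hsub hT, h1]
      omega
    · intro a ha b hb hab
      simp only [mem_filter, mem_univ, true_and] at ha hb
      exact Subtype.ext (Prod.ext (ha.2.trans hb.2.symm) hab)
    · intro c hc
      rw [mem_Ico] at hc
      have hm : (i, c) ∈ skewCells lam mu := by
        refine mem_skewCells.2 ⟨?_, hc.2.trans_le (hg.le_rowLen _ _)⟩
        rw [← hg.zero]
        exact (hg.le_of_le i (Nat.zero_le _)).trans hc.1
      refine ⟨⟨(i, c), hm⟩, ?_, rfl⟩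
      simp only [mem_filter, mem_univ, true_and, and_true]
      have h1 := (lt_rowPattern_iff_of_mem hsub hT k ⟨(i, c), hm⟩).not.1 (not_lt.2 hc.1)
      have h2 := (lt_rowPattern_iff_of_mem hsub hT (k + 1) ⟨(i, c), hm⟩).1 hc.2
      exact Fin.ext (by omega)
  simp_rw [hrow]
  have := sum_tsub_distrib (range (lam.colLen 0)) (f := rowPattern T (k + 1)) (g := rowPattern T k)
    (fun i _ => hg.mono k i)
  exact this

/-- The monomial with exponents `α`. -/
def mono {n : ℕ} (α : Fin n → ℕ) : MvPolynomial (Fin n) ℤ := ∏ k, MvPolynomial.X k ^ α k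

open Classical in
theorem skewSchurPoly_eq_sum_rowPatterns (n : ℕ) {lam mu : YoungDiagram} (hsub : mu ≤ lam) :
    skewSchurPoly n lam mu =
      ∑ g ∈ rowPatterns n lam mu, mono (patternWeight (lam.colLen 0) n g) := by
  rw [rowPatterns, sum_image, skewSchurPoly]
  · refine sum_congr (by congr) fun T hT => ?_
    have hT : IsSemistandard T := by simpa using hT
    rw [← prod_fiberwise univ T, mono]
    refine prod_congr rfl fun k _ => ?_
    rw [prod_congr rfl fun a ha => by rw [(mem_filter.1 ha).2], prod_const,
      card_fiber_eq_patternWeight hsub hT]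
  · intro T hT T' hT' h
    exact rowPattern_injOn hsub (by simpa using hT) (by simpa using hT') h

/-! ### Truncated Bender-Knuth involutions -/

/-- The number of boxes of the `k`-th shape of a pattern in the columns from `J` on. -/
def truncSum (L : ℕ) (g : ℕ → ℕ → ℕ) (J k : ℕ) : ℕ := ∑ i ∈ range L, (g k i - J)

/-- The Bender-Knuth involution on the columns left of `J`, exchanging the numbers of entries `k`
and `k + 1`. -/
def toggle (J k : ℕ) (g : ℕ → ℕ → ℕ) (m i : ℕ) : ℕ :=
  if m = k + 1 then
    if J < g (k + 1) i then g (k + 1) i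
    else min (min (g (k + 2) i) J) (if i = 0 then J else g k (i - 1)) +
      max (g (k + 2) (i + 1)) (g k i) - g (k + 1) i
  else g m i

theorem toggle_of_ne {J k : ℕ} {g : ℕ → ℕ → ℕ} {m : ℕ} (h : m ≠ k + 1) (i : ℕ) :
    toggle J k g m i = g m i := if_neg h

theorem rowSum_toggle_of_ne {J k L : ℕ} {g : ℕ → ℕ → ℕ} {m : ℕ} (h : m ≠ k + 1) :
    rowSum L (toggle J k g) m = rowSum L g m :=
  sum_congr rfl fun i _ => toggle_of_ne h i

section Toggle

variable {n : ℕ} {lam mu : YoungDiagram} {g : ℕ → ℕ → ℕ} {J k : ℕ}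

theorem toggle_of_lt {i : ℕ} (h : J < g (k + 1) i) : toggle J k g (k + 1) i = g (k + 1) i := by
  simp [toggle, h]

theorem IsRowPattern.toggle_of_le (hg : IsRowPattern n lam mu g) {i : ℕ} (h : g (k + 1) i ≤ J) :
    toggle J k g (k + 1) i + g (k + 1) i =
      min (min (g (k + 2) i) J) (if i = 0 then J else g k (i - 1)) +
        max (g (k + 2) (i + 1)) (g k i) ∧
    max (g (k + 2) (i + 1)) (g k i) ≤ toggle J k g (k + 1) i ∧
    toggle J k g (k + 1) i ≤ min (min (g (k + 2) i) J) (if i = 0 then J else g k (i - 1)) := by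
  have h1 := hg.mono (k + 1) i
  have h2 := hg.mono k i
  have h3 := hg.interlace (k + 1) i
  have h4 : g (k + 1) i ≤ (if i = 0 then J else g k (i - 1)) := by
    split_ifs with hi
    · exact h
    · have := hg.interlace k (i - 1)
      rwa [Nat.sub_add_cancel (by omega)] at this
  rw [toggle, if_pos rfl, if_neg (not_lt.2 h)]
  generalize (if i = 0 then J else g k (i - 1)) = p at *
  simp only [show k + 1 + 1 = k + 2 from rfl] at *
  omega

theorem IsRowPattern.toggle (hg : IsRowPattern n lam mu g) (hk : k + 2 ≤ n)
    (hJ : ∀ i, J < g (k + 1) i → J < g k i) : IsRowPattern n lam mu (toggle J k g) where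
  zero i := by rw [toggle_of_ne (by omega), hg.zero]
  top m hm i := by rw [toggle_of_ne (by omega), hg.top m hm]
  mono m i := by
    by_cases h1 : m = k + 1
    · subst h1
      rw [toggle_of_ne (m := k + 1 + 1) (by omega)]
      obtain h | h := lt_or_ge J (g (k + 1) i)
      · rw [toggle_of_lt h]
        exact hg.mono _ _
      · have := hg.toggle_of_le h
        exact (this.2.2.trans (min_le_left _ _)).trans (min_le_left _ _)
    · rw [toggle_of_ne h1]
      by_cases h2 : m = k
      · subst h2
        obtain h | h := lt_or_ge J (g (m + 1) i)
        · rw [toggle_of_lt h]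
          exact hg.mono _ _
        · exact (le_max_right _ _).trans (hg.toggle_of_le h).2.1
      · rw [toggle_of_ne (by omega)]
        exact hg.mono _ _
  interlace m i := by
    by_cases h1 : m = k + 1
    · subst h1
      rw [toggle_of_ne (m := k + 1 + 1) (by omega)]
      obtain h | h := lt_or_ge J (g (k + 1) i)
      · rw [toggle_of_lt h]
        exact hg.interlace _ _
      · exact (le_max_left _ _).trans (hg.toggle_of_le h).2.1
    · rw [toggle_of_ne h1]
      by_cases h2 : m = k
      · subst h2
        obtain h | h := lt_or_ge J (g (m + 1) (i + 1))
        · rw [toggle_of_lt h]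
          exact hg.interlace _ _
        · have := (hg.toggle_of_le h).2.2.trans (min_le_right _ _)
          simpa using this
      · rw [toggle_of_ne (by omega)]
        exact hg.interlace _ _

theorem IsRowPattern.lt_toggle_iff (hg : IsRowPattern n lam mu g) (i : ℕ) :
    J < SkewSchur.toggle J k g (k + 1) i ↔ J < g (k + 1) i := by
  obtain h | h := lt_or_ge J (g (k + 1) i)
  · rw [toggle_of_lt h]
  · have := (hg.toggle_of_le h).2.2
    have : SkewSchur.toggle J k g (k + 1) i ≤ J := by omega
    omega

theorem IsRowPattern.toggle_toggle (hg : IsRowPattern n lam mu g) (hk : k + 2 ≤ n)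
    (hJ : ∀ i, J < g (k + 1) i → J < g k i) :
    SkewSchur.toggle J k (SkewSchur.toggle J k g) = g := by
  funext m i
  by_cases h1 : m = k + 1
  · subst h1
    obtain h | h := lt_or_ge J (g (k + 1) i)
    · rw [toggle_of_lt ((hg.lt_toggle_iff i).2 h), toggle_of_lt h]
    · have h2 := (hg.toggle_of_le h).1
      have h3 : SkewSchur.toggle J k g (k + 1) i ≤ J := by
        rw [← not_lt, hg.lt_toggle_iff]
        omega
      have h4 := ((hg.toggle hk hJ).toggle_of_le h3).1
      rw [toggle_of_ne (m := k + 2) (by omega), toggle_of_ne (m := k + 2) (by omega),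
        toggle_of_ne (m := k) (by omega), toggle_of_ne (m := k) (by omega)] at h4
      omega
  · rw [toggle_of_ne h1, toggle_of_ne h1]

/-- Only ends of rows at or left of `J` move, and they stay there. So the involution cannot disturb
the failure of the lattice condition that selects `J` and `k`. -/
theorem IsRowPattern.truncSum_toggle (hg : IsRowPattern n lam mu g) (L : ℕ) {J' : ℕ} (h : J ≤ J')
    (m : ℕ) : truncSum L (SkewSchur.toggle J k g) J' m = truncSum L g J' m := by
  refine sum_congr rfl fun i _ => ?_
  by_cases h1 : m = k + 1
  · subst h1
    obtain h2 | h2 := lt_or_ge J (g (k + 1) i)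
    · rw [toggle_of_lt h2]
    · have := hg.lt_toggle_iff (J := J) (k := k) i
      omega
  · rw [toggle_of_ne h1]

/-- The minimum in row `i + 1` and the maximum in row `i` involve the same two numbers, so together
they give their sum. -/
theorem sum_min_add_sum_max (A B : ℕ → ℕ) (J L : ℕ) :
    ∑ i ∈ range (L + 1), min (min (A i) J) (if i = 0 then J else B (i - 1)) +
      ∑ i ∈ range L, max (min (A (i + 1)) J) (min (B i) J) =
    ∑ i ∈ range (L + 1), min (A i) J + ∑ i ∈ range L, min (B i) J := by
  induction L with
  | zero => simp
  | succ L ih =>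
    rw [sum_range_succ _ (L + 1), sum_range_succ _ (L + 1),
      sum_range_succ (fun i => max (min (A (i + 1)) J) (min (B i) J)) L,
      sum_range_succ (fun i => min (B i) J) L]
    simp only [Nat.add_eq_zero_iff, one_ne_zero, and_false, if_false, Nat.add_sub_cancel]
    omega

theorem IsRowPattern.eq_zero (hg : IsRowPattern n lam mu g) (k : ℕ) {i : ℕ}
    (h : lam.colLen 0 ≤ i) : g k i = 0 := by
  have := hg.le_rowLen k i
  rw [rowLen_eq_zero h] at this
  omega

/-- After capping at `J`, moved and fixed rows obey the same reflection identity, up to twice the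
excess over `J`. For a fixed row both bounds are then `J`; for the lower one this is what `hJ` (no
entry `k` in column `J`) provides. -/
theorem IsRowPattern.rowSum_toggle (hg : IsRowPattern n lam mu g)
    (hJ : ∀ i, J < g (k + 1) i → J < g k i) {L : ℕ} (hL : lam.colLen 0 ≤ L) :
    rowSum L (SkewSchur.toggle J k g) (k + 1) + rowSum L g (k + 1) +
        (truncSum L g J (k + 2) + truncSum L g J k) =
      rowSum L g (k + 2) + rowSum L g k + 2 * truncSum L g J (k + 1) := by
  have hrow : ∀ i, SkewSchur.toggle J k g (k + 1) i + g (k + 1) i =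
      min (min (g (k + 2) i) J) (if i = 0 then J else g k (i - 1)) +
        max (min (g (k + 2) (i + 1)) J) (min (g k i) J) + 2 * (g (k + 1) i - J) := by
    intro i
    have h1 := hg.mono (k + 1) i
    have h2 := hg.mono k i
    have h3 := hg.interlace (k + 1) i
    have h4 := hJ i
    have h5 : g (k + 1) i ≤ J ∨ J < (if i = 0 then J + 1 else g k (i - 1)) := by
      split_ifs with hi
      · omega
      · have := hg.interlace k (i - 1)
        rw [Nat.sub_add_cancel (by omega)] at this
        omega
    simp only [show k + 1 + 1 = k + 2 from rfl] at *
    obtain h | h := lt_or_ge J (g (k + 1) i)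
    · rw [toggle_of_lt h]
      split_ifs at h5 ⊢ <;> omega
    · have := (hg.toggle_of_le h).1
      omega
  have hsum := sum_congr (rfl : range L = range L) fun i _ => hrow i
  simp only [sum_add_distrib, ← mul_sum] at hsum
  have htel := sum_min_add_sum_max (g (k + 2)) (g k) J L
  rw [sum_range_succ, sum_range_succ, hg.eq_zero _ hL] at htel
  have hA : ∑ i ∈ range L, min (g (k + 2) i) J + truncSum L g J (k + 2) = rowSum L g (k + 2) := by
    rw [truncSum, rowSum, ← sum_add_distrib]
    exact sum_congr rfl fun i _ => by omega
  have hB : ∑ i ∈ range L, min (g k i) J + truncSum L g J k = rowSum L g k := by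
    rw [truncSum, rowSum, ← sum_add_distrib]
    exact sum_congr rfl fun i _ => by omega
  simp only [rowSum, truncSum] at *
  omega

/-! ### The first failure of the lattice condition -/

/-- The reverse reading word, by columns from right to left, of the tableau is a lattice word. -/
def IsLattice (n L : ℕ) (g : ℕ → ℕ → ℕ) : Prop :=
  ∀ J k, k + 2 ≤ n → truncSum L g J (k + 2) + truncSum L g J k ≤ 2 * truncSum L g J (k + 1)

/-- Reading by columns from right to left, the lattice condition fails first in column `J`, and
`k` is the least entry with which it fails there. -/
structure IsFirstBad (n L : ℕ) (g : ℕ → ℕ → ℕ) (J k : ℕ) : Prop where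
  le : k + 2 ≤ n
  bad : 2 * truncSum L g J (k + 1) < truncSum L g J (k + 2) + truncSum L g J k
  col : ∀ J', J < J' → ∀ k, k + 2 ≤ n →
    truncSum L g J' (k + 2) + truncSum L g J' k ≤ 2 * truncSum L g J' (k + 1)
  row : ∀ k' < k, truncSum L g J (k' + 2) + truncSum L g J k' ≤ 2 * truncSum L g J (k' + 1)

theorem IsFirstBad.unique {L J' k' : ℕ} (h : IsFirstBad n L g J k) (h' : IsFirstBad n L g J' k') :
    J = J' ∧ k = k' := by
  have hJ : J = J' := by
    obtain hlt | heq | hlt := lt_trichotomy J J'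
    · have := h.col _ hlt _ h'.le
      have := h'.bad
      omega
    · exact heq
    · have := h'.col _ hlt _ h.le
      have := h.bad
      omega
  subst hJ
  refine ⟨rfl, ?_⟩
  obtain hlt | heq | hlt := lt_trichotomy k k'
  · have := h'.row _ hlt
    have := h.bad
    omega
  · exact heq
  · have := h.row _ hlt
    have := h'.bad
    omega

theorem IsRowPattern.truncSum_eq_zero (hg : IsRowPattern n lam mu g) (L : ℕ)
    (hJ : lam.rowLen 0 ≤ J) (k : ℕ) : truncSum L g J k = 0 :=
  sum_eq_zero fun i _ => by
    have := hg.le_rowLen k i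
    have := lam.rowLen_anti 0 i (Nat.zero_le i)
    omega

theorem IsRowPattern.exists_isFirstBad (hg : IsRowPattern n lam mu g) {L : ℕ}
    (h : ¬ IsLattice n L g) : ∃ J k, IsFirstBad n L g J k := by
  classical
  simp only [IsLattice, not_forall, not_le] at h
  obtain ⟨J₀, k₀, hk₀, hbad⟩ := h
  let P : ℕ → Prop := fun J => ∃ k, k + 2 ≤ n ∧
    2 * truncSum L g J (k + 1) < truncSum L g J (k + 2) + truncSum L g J k
  have hPJ : ∀ J, P J → J ≤ lam.rowLen 0 := by
    rintro J ⟨k, -, hb⟩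
    by_contra hJ
    rw [hg.truncSum_eq_zero L (by omega), hg.truncSum_eq_zero L (by omega),
      hg.truncSum_eq_zero L (by omega)] at hb
    omega
  have hP₀ : P J₀ := ⟨k₀, hk₀, hbad⟩
  have hP := Nat.findGreatest_spec (hPJ _ hP₀) hP₀
  refine ⟨Nat.findGreatest P (lam.rowLen 0), Nat.find hP, (Nat.find_spec hP).1,
    (Nat.find_spec hP).2, fun J' hJ' k hk => ?_, fun k' hk' => ?_⟩
  · by_contra! hcon
    have hPJ' : P J' := ⟨k, hk, hcon⟩
    exact absurd hPJ' (Nat.findGreatest_is_greatest hJ' (hPJ _ hPJ'))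
  · by_contra! hcon
    have h1 := (Nat.find_spec hP).1
    exact Nat.find_min hP hk' ⟨by omega, hcon⟩

/-- One column contains each entry at most once, so adding column `J` to a reading that was still
good can break the condition only by containing `k + 1` but not `k`, and then by exactly one. -/
theorem IsRowPattern.isFirstBad_spec (hg : IsRowPattern n lam mu g) {L : ℕ}
    (hL : lam.colLen 0 ≤ L) (h : IsFirstBad n L g J k) :
    (∀ i, J < g (k + 1) i → J < g k i) ∧
      truncSum L g J (k + 2) + truncSum L g J k = 2 * truncSum L g J (k + 1) + 1 := by
  -- `D m` is the number of boxes of the `m`-th shape in column `J`.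
  let D : ℕ → ℕ := fun m => ∑ i ∈ range L, if J < g m i then 1 else 0
  have hD : ∀ m, truncSum L g J m = truncSum L g (J + 1) m + D m := fun m => by
    rw [truncSum, truncSum, ← sum_add_distrib]
    exact sum_congr rfl fun i _ => by split_ifs <;> omega
  have hstep : ∀ m, D (m + 1) ≤ D m + 1 := fun m => by
    have h1 : D (m + 1) ≤ ∑ i ∈ range (L + 1), if J < g (m + 1) i then 1 else 0 := by
      rw [sum_range_succ]
      exact Nat.le_add_right _ _
    rw [sum_range_succ'] at h1
    have h2 : ∑ i ∈ range L, (if J < g (m + 1) (i + 1) then 1 else 0) ≤ D m :=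
      sum_le_sum fun i _ => by
        have := hg.interlace m i
        split_ifs <;> omega
    split_ifs at h1 <;> omega
  have hle : ∀ i ∈ range L,
      (if J < g k i then 1 else 0) ≤ (if J < g (k + 1) i then 1 else 0) := fun i _ => by
    have := hg.mono k i
    split_ifs <;> omega
  have hmono : D k ≤ D (k + 1) := sum_le_sum hle
  have h0 := h.bad
  have h1 := h.col (J + 1) (by omega) k h.le
  have h2 := hstep (k + 1)
  rw [hD, hD, hD] at h0 ⊢
  simp only [show k + 1 + 1 = k + 2 from rfl] at *
  refine ⟨fun i hi => ?_, by omega⟩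
  have heq : D k = D (k + 1) := by omega
  have := (sum_eq_sum_iff_of_le hle).1 heq i (mem_range.2 ?_)
  · rw [if_pos hi] at this
    by_contra hcon
    rw [if_neg hcon] at this
    omega
  · by_contra hcon
    rw [hg.eq_zero _ (hL.trans (not_lt.1 hcon))] at hi
    omega

theorem IsRowPattern.isFirstBad_toggle (hg : IsRowPattern n lam mu g) {L : ℕ}
    (h : IsFirstBad n L g J k) : IsFirstBad n L (SkewSchur.toggle J k g) J k where
  le := h.le
  bad := by
    rw [hg.truncSum_toggle L le_rfl, hg.truncSum_toggle L le_rfl, hg.truncSum_toggle L le_rfl]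
    exact h.bad
  col J' hJ' k' hk' := by
    rw [hg.truncSum_toggle L hJ'.le, hg.truncSum_toggle L hJ'.le, hg.truncSum_toggle L hJ'.le]
    exact h.col J' hJ' k' hk'
  row k' hk' := by
    rw [hg.truncSum_toggle L le_rfl, hg.truncSum_toggle L le_rfl, hg.truncSum_toggle L le_rfl]
    exact h.row k' hk'

end Toggle

/-! ### Alternants -/

section Alternant

variable {n : ℕ}

/-- The alternant `a_α = det (x_i ^ α_j)`. -/
def alternant (α : Fin n → ℕ) : MvPolynomial (Fin n) ℤ :=
  Matrix.det (Matrix.of fun i j => MvPolynomial.X i ^ α j)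

theorem rename_mono (w : Equiv.Perm (Fin n)) (α : Fin n → ℕ) :
    MvPolynomial.rename w (mono α) = ∏ i, MvPolynomial.X (w i) ^ α i := by
  simp [mono, map_prod]

theorem mono_mul_mono (α β : Fin n → ℕ) : mono α * mono β = mono (α + β) := by
  simp [mono, pow_add, prod_mul_distrib]

theorem mono_eq_monomial (α : Fin n → ℕ) :
    mono α = MvPolynomial.monomial (Finsupp.equivFunOnFinite.symm α) 1 := by
  rw [MvPolynomial.monomial_eq, mono, Finsupp.prod_fintype _ _ (by simp)]
  simp

theorem rename_mono_eq_mono (w : Equiv.Perm (Fin n)) (α : Fin n → ℕ) :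
    MvPolynomial.rename w (mono α) = mono (α ∘ w.symm) := by
  rw [rename_mono, mono, ← Equiv.prod_comp w fun x => MvPolynomial.X x ^ (α ∘ w.symm) x]
  simp

theorem alternant_eq_sum (α : Fin n → ℕ) :
    alternant α = ∑ w : Equiv.Perm (Fin n), Equiv.Perm.sign w • MvPolynomial.rename w (mono α) := by
  rw [alternant, Matrix.det_apply]
  exact sum_congr rfl fun w _ => by rw [rename_mono]; rfl

theorem alternant_comp (α : Fin n → ℕ) (w : Equiv.Perm (Fin n)) :
    alternant (α ∘ w) = ((Equiv.Perm.sign w : ℤ) : MvPolynomial (Fin n) ℤ) * alternant α := by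
  rw [alternant, alternant, ← Matrix.det_permute']
  rfl

/-- In the term of `w`, the symmetric factor may be replaced by its image under `w`, so that `w`
acts on a product of monomials. -/
theorem alternant_mul_of_isSymmetric {ι : Type*} (s : Finset ι) (wt : ι → Fin n → ℕ)
    (h : (∑ a ∈ s, mono (wt a)).IsSymmetric) (δ : Fin n → ℕ) :
    alternant δ * ∑ a ∈ s, mono (wt a) = ∑ a ∈ s, alternant (δ + wt a) := by
  simp_rw [alternant_eq_sum]
  rw [sum_comm, sum_mul]
  refine sum_congr rfl fun w _ => ?_
  rw [← smul_sum, smul_mul_assoc]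
  congr 1
  nth_rw 1 [← h w]
  rw [← map_mul, mul_sum, map_sum]
  simp_rw [mono_mul_mono]

/-- Permuting a strictly decreasing exponent gives a strictly decreasing one only for the identity.
-/
theorem coeff_alternant {α β : Fin n → ℕ} (hα : StrictAnti α) (hβ : StrictAnti β) :
    (alternant β).coeff (Finsupp.equivFunOnFinite.symm α) = if β = α then 1 else 0 := by
  classical
  rw [alternant_eq_sum, MvPolynomial.coeff_sum, sum_eq_single 1]
  · have h1 : β ∘ (1 : Equiv.Perm (Fin n)).symm = β := rfl
    rw [Equiv.Perm.sign_one, one_smul, rename_mono_eq_mono, h1, mono_eq_monomial,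
      MvPolynomial.coeff_monomial]
    simp only [Finsupp.equivFunOnFinite.symm.injective.eq_iff]
  · intro w _ hw
    rw [rename_mono_eq_mono, mono_eq_monomial, Units.smul_def, MvPolynomial.coeff_smul,
      MvPolynomial.coeff_monomial, if_neg, smul_zero]
    intro h
    have h := Finsupp.equivFunOnFinite.symm.injective h
    apply hw
    have hmono : StrictMono w.symm := fun a b hab => by
      have := hα hab
      rw [← h] at this
      exact hβ.lt_iff_gt.1 this
    have hid : w.symm = 1 := by
      ext i
      have := Subsingleton.elim (hmono.orderIsoOfSurjective _ w.symm.surjective) (OrderIso.refl _)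
      exact congrArg Fin.val (DFunLike.congr_fun this i)
    have : w = w.symm.symm := rfl
    rw [this, hid]
    rfl
  · simp

end Alternant

/-! ### Symmetry and the Littlewood-Richardson rule -/

section Symmetry

variable {n : ℕ} {lam mu : YoungDiagram}

theorem IsRowPattern.patternWeight_toggle {g : ℕ → ℕ → ℕ} {J k : ℕ}
    (hg : IsRowPattern n lam mu g) (hk : k + 2 ≤ n)
    (hJ : ∀ i, J < g (k + 1) i → J < g k i) {L : ℕ} (hL : lam.colLen 0 ≤ L) (m : Fin n) :
    (m : ℕ) = k ∧ patternWeight L n (SkewSchur.toggle J k g) m +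
        (truncSum L g J (k + 2) + truncSum L g J k) =
        patternWeight L n g ⟨k + 1, by omega⟩ + 2 * truncSum L g J (k + 1) ∨
    (m : ℕ) = k + 1 ∧ patternWeight L n (SkewSchur.toggle J k g) m + 2 * truncSum L g J (k + 1) =
        patternWeight L n g ⟨k, by omega⟩ + (truncSum L g J (k + 2) + truncSum L g J k) ∨
    (m : ℕ) ≠ k ∧ (m : ℕ) ≠ k + 1 ∧
        patternWeight L n (SkewSchur.toggle J k g) m = patternWeight L n g m := by
  have h1 := hg.rowSum_toggle hJ hL
  have h2 := hg.rowSum_le L k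
  have h3 := hg.rowSum_le L (k + 1)
  have h4 := (hg.toggle hk hJ).rowSum_le L k
  have h5 := (hg.toggle hk hJ).rowSum_le L (k + 1)
  rw [rowSum_toggle_of_ne (by omega)] at h4
  rw [rowSum_toggle_of_ne (m := k + 1 + 1) (by omega)] at h5
  simp only [patternWeight]
  simp only [show k + 1 + 1 = k + 2 from rfl] at *
  by_cases hmk : (m : ℕ) = k
  · left
    rw [hmk, rowSum_toggle_of_ne (m := k) (by omega)]
    omega
  by_cases hmk' : (m : ℕ) = k + 1
  · right; left
    rw [hmk', rowSum_toggle_of_ne (m := k + 1 + 1) (by omega)]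
    refine ⟨rfl, ?_⟩
    simp only [show k + 1 + 1 = k + 2 from rfl] at *
    omega
  · right; right
    rw [rowSum_toggle_of_ne (by omega), rowSum_toggle_of_ne (by omega)]
    exact ⟨hmk, hmk', rfl⟩

theorem swap_apply_val {n k : ℕ} (hk : k + 2 ≤ n) (m : Fin n) :
    (m : ℕ) = k ∧ Equiv.swap (⟨k, by omega⟩ : Fin n) ⟨k + 1, by omega⟩ m = ⟨k + 1, by omega⟩ ∨
    (m : ℕ) = k + 1 ∧ Equiv.swap (⟨k, by omega⟩ : Fin n) ⟨k + 1, by omega⟩ m = ⟨k, by omega⟩ ∨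
    (m : ℕ) ≠ k ∧ (m : ℕ) ≠ k + 1 ∧
      Equiv.swap (⟨k, by omega⟩ : Fin n) ⟨k + 1, by omega⟩ m = m := by
  by_cases hmk : (m : ℕ) = k
  · have h : m = ⟨k, by omega⟩ := Fin.ext hmk
    exact .inl ⟨hmk, by rw [h, Equiv.swap_apply_left]⟩
  by_cases hmk' : (m : ℕ) = k + 1
  · have h : m = ⟨k + 1, by omega⟩ := Fin.ext hmk'
    exact .inr (.inl ⟨hmk', by rw [h, Equiv.swap_apply_right]⟩)
  · refine .inr (.inr ⟨hmk, hmk', Equiv.swap_apply_of_ne_of_ne ?_ ?_⟩)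
    · exact fun h => hmk (congrArg Fin.val h)
    · exact fun h => hmk' (congrArg Fin.val h)

theorem rename_swap_skewSchurPoly (hsub : mu ≤ lam) {k : ℕ} (hk : k + 2 ≤ n) :
    MvPolynomial.rename (Equiv.swap (⟨k, by omega⟩ : Fin n) ⟨k + 1, by omega⟩)
      (skewSchurPoly n lam mu) = skewSchurPoly n lam mu := by
  rw [skewSchurPoly_eq_sum_rowPatterns n hsub, map_sum]
  -- With `J = λ_1` the involution acts on the whole tableau and this condition is vacuous.
  have hJ : ∀ g ∈ rowPatterns n lam mu, ∀ i, lam.rowLen 0 < g (k + 1) i → lam.rowLen 0 < g k i := by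
    intro g hg i h
    have := ((mem_rowPatterns hsub).1 hg).le_rowLen (k + 1) i
    have := lam.rowLen_anti 0 i (Nat.zero_le i)
    omega
  have hmem : ∀ g ∈ rowPatterns n lam mu, toggle (lam.rowLen 0) k g ∈ rowPatterns n lam mu :=
    fun g hg => (mem_rowPatterns hsub).2 (((mem_rowPatterns hsub).1 hg).toggle hk (hJ g hg))
  refine sum_nbij' (toggle (lam.rowLen 0) k) (toggle (lam.rowLen 0) k) hmem hmem
    (fun g hg => ((mem_rowPatterns hsub).1 hg).toggle_toggle hk (hJ g hg))
    (fun g hg => ((mem_rowPatterns hsub).1 hg).toggle_toggle hk (hJ g hg)) fun g hg => ?_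
  have hg' := (mem_rowPatterns hsub).1 hg
  rw [rename_mono_eq_mono, Equiv.symm_swap]
  congr 1
  funext m
  have h1 := hg'.patternWeight_toggle hk (hJ g hg) le_rfl m
  rw [hg'.truncSum_eq_zero _ le_rfl, hg'.truncSum_eq_zero _ le_rfl,
    hg'.truncSum_eq_zero _ le_rfl] at h1
  simp only [Function.comp_apply]
  obtain ⟨ha, hb⟩ | ⟨ha, hb⟩ | ⟨ha, ha', hb⟩ := swap_apply_val hk m
  · rw [hb]; omega
  · rw [hb]; omega
  · rw [hb]; omega

theorem skewSchurPoly_isSymmetric (hsub : mu ≤ lam) : (skewSchurPoly n lam mu).IsSymmetric := by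
  intro w
  cases n with
  | zero => rw [Subsingleton.elim w 1]; simp
  | succ n =>
    have hw : w ∈ Submonoid.closure (Set.range fun i : Fin n => Equiv.swap i.castSucc i.succ) := by
      rw [Equiv.Perm.mclosure_swap_castSucc_succ]
      trivial
    induction hw using Submonoid.closure_induction with
    | mem x hx =>
      obtain ⟨i, rfl⟩ := hx
      exact rename_swap_skewSchurPoly hsub (k := i) (by omega)
    | one => simp
    | mul x y _ _ hx hy =>
      nth_rw 2 [← hx]
      nth_rw 2 [← hy]
      rw [MvPolynomial.rename_rename]
      rfl

/-- The staircase `(n - 1, …, 1, 0)`. -/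
def staircase (n : ℕ) (i : Fin n) : ℕ := n - 1 - i

/-- The lattice condition fails by exactly one, which matches the step of the staircase: the two
exponents differ by an adjacent transposition, so the alternants are opposite. -/
theorem IsRowPattern.alternant_add_alternant_toggle {g : ℕ → ℕ → ℕ} {J k L : ℕ}
    (hg : IsRowPattern n lam mu g) (hL : lam.colLen 0 ≤ L) (h : IsFirstBad n L g J k) :
    alternant (staircase n + patternWeight L n g) +
      alternant (staircase n + patternWeight L n (SkewSchur.toggle J k g)) = 0 := by
  obtain ⟨hJ, he⟩ := hg.isFirstBad_spec hL h
  have hk := h.le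
  have hcomp : staircase n + patternWeight L n (SkewSchur.toggle J k g) =
      (staircase n + patternWeight L n g) ∘ Equiv.swap ⟨k, by omega⟩ ⟨k + 1, by omega⟩ := by
    funext m
    have h1 := hg.patternWeight_toggle hk hJ hL m
    simp only [Function.comp_apply, Pi.add_apply]
    obtain ⟨ha, hb⟩ | ⟨ha, hb⟩ | ⟨ha, ha', hb⟩ := swap_apply_val hk m
    · rw [hb]; simp only [staircase]; omega
    · rw [hb]; simp only [staircase]; omega
    · rw [hb]; omega
  rw [hcomp, alternant_comp, Equiv.Perm.sign_swap (by simp)]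
  simp

open Classical in
/-- The Littlewood-Richardson rule: only the lattice patterns contribute. -/
theorem alternant_mul_skewSchurPoly (hsub : mu ≤ lam) :
    alternant (staircase n) * skewSchurPoly n lam mu =
      ∑ g ∈ rowPatterns n lam mu with IsLattice n (lam.colLen 0) g,
        alternant (staircase n + patternWeight (lam.colLen 0) n g) := by
  have hsymm := skewSchurPoly_isSymmetric (n := n) hsub
  rw [skewSchurPoly_eq_sum_rowPatterns n hsub] at hsymm ⊢
  rw [alternant_mul_of_isSymmetric _ _ hsymm, ← sum_filter_add_sum_filter_not _
    (fun g => IsLattice n (lam.colLen 0) g), add_eq_left]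
  -- The implication sits inside the existential so that `choose` yields a total function; `(0, 0)`
  -- is a dummy value for the other patterns.
  have hbad : ∀ g, ∃ p : ℕ × ℕ, g ∈ ({g ∈ rowPatterns n lam mu | ¬ IsLattice n (lam.colLen 0) g}) →
      IsFirstBad n (lam.colLen 0) g p.1 p.2 := by
    intro g
    by_cases hg : g ∈ ({g ∈ rowPatterns n lam mu | ¬ IsLattice n (lam.colLen 0) g})
    · obtain ⟨J, k, h⟩ := ((mem_rowPatterns hsub).1 (mem_filter.1 hg).1).exists_isFirstBad
        (mem_filter.1 hg).2
      exact ⟨(J, k), fun _ => h⟩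
    · exact ⟨(0, 0), fun h => absurd h hg⟩
  choose p hp using hbad
  have hrow : ∀ g ∈ ({g ∈ rowPatterns n lam mu | ¬ IsLattice n (lam.colLen 0) g}),
      IsRowPattern n lam mu g := fun g hg => (mem_rowPatterns hsub).1 (mem_filter.1 hg).1
  have hmem : ∀ g (_ : g ∈ ({g ∈ rowPatterns n lam mu | ¬ IsLattice n (lam.colLen 0) g})),
      toggle (p g).1 (p g).2 g ∈
        ({g ∈ rowPatterns n lam mu | ¬ IsLattice n (lam.colLen 0) g}) := by
    intro g hg
    have h1 := (hrow g hg).isFirstBad_toggle (hp g hg)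
    have h2 := (hrow g hg).isFirstBad_spec le_rfl (hp g hg)
    refine mem_filter.2 ⟨(mem_rowPatterns hsub).2 ((hrow g hg).toggle h1.le h2.1), fun hlat => ?_⟩
    have := hlat (p g).1 (p g).2 h1.le
    have := h1.bad
    omega
  refine sum_involution (fun g _ => toggle (p g).1 (p g).2 g) ?_ ?_ hmem ?_
  · intro g hg
    exact (hrow g hg).alternant_add_alternant_toggle le_rfl (hp g hg)
  · intro g hg hne heq
    have h := (hrow g hg).alternant_add_alternant_toggle le_rfl (hp g hg)
    rw [heq] at h
    exact hne (add_self_eq_zero.1 h)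
  · intro g hg
    have h1 := (hrow g hg).isFirstBad_toggle (hp g hg)
    -- The image has the same first failure, so the same toggle is applied twice.
    have h2 := h1.unique (hp _ (hmem g hg))
    have h3 := (hrow g hg).isFirstBad_spec le_rfl (hp g hg)
    rw [← h2.1, ← h2.2]
    exact (hrow g hg).toggle_toggle h1.le h3.1

/-- The lattice condition for `J = 0` says that the content decreases weakly. -/
theorem IsRowPattern.strictAnti_weight {g : ℕ → ℕ → ℕ} {L : ℕ} (hg : IsRowPattern n lam mu g)
    (h : IsLattice n L g) : StrictAnti (staircase n + patternWeight L n g) := by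
  cases n with
  | zero => exact fun a => a.elim0
  | succ n =>
    refine Fin.strictAnti_iff_succ_lt.2 fun i => ?_
    have h1 := h 0 i (by omega)
    have h2 := hg.rowSum_le L i
    have h3 := hg.rowSum_le L (i + 1)
    simp only [truncSum, Nat.sub_zero] at h1
    simp only [Pi.add_apply, staircase, patternWeight, Fin.val_succ, Fin.val_castSucc]
    simp only [rowSum] at *
    simp only [show (i : ℕ) + 1 + 1 = i + 2 from rfl] at *
    omega

end Symmetry

/-! ### Straight shapes -/

section Straight

variable {n : ℕ} {kap : YoungDiagram}

theorem eq_of_rowLen_eq {kap kap' : YoungDiagram} (h : ∀ i, kap.rowLen i = kap'.rowLen i) :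
    kap = kap' := by
  ext ⟨i, j⟩
  rw [YoungDiagram.mem_cells, YoungDiagram.mem_cells, YoungDiagram.mem_iff_lt_rowLen,
    YoungDiagram.mem_iff_lt_rowLen, h]

theorem rowLen_bot (i : ℕ) : (⊥ : YoungDiagram).rowLen i = 0 := by
  by_contra h
  exact YoungDiagram.notMem_bot (i, 0) (YoungDiagram.mem_iff_lt_rowLen.2 (Nat.pos_of_ne_zero h))

/-- The pattern of the tableau of shape `kap` in which the entries of row `i` are `i`. -/
def straightPattern (kap : YoungDiagram) (k i : ℕ) : ℕ := if i < k then kap.rowLen i else 0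

theorem isRowPattern_straightPattern (h : kap.colLen 0 ≤ n) :
    IsRowPattern n kap ⊥ (straightPattern kap) where
  zero i := by simp [straightPattern, rowLen_bot]
  top k hk i := by
    rw [straightPattern, ite_eq_left_iff, not_lt]
    intro hi
    rw [rowLen_eq_zero (by omega)]
  mono k i := by
    simp only [straightPattern]
    split_ifs <;> omega
  interlace k i := by
    have := kap.rowLen_anti i (i + 1) (by omega)
    simp only [straightPattern]
    split_ifs <;> omega

theorem truncSum_straightPattern (J k : ℕ) :
    truncSum (kap.colLen 0) (straightPattern kap) J (k + 1) =
      truncSum (kap.colLen 0) (straightPattern kap) J k + (kap.rowLen k - J) := by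
  have h1 : kap.rowLen k - J = ∑ i ∈ range (kap.colLen 0), if i = k then kap.rowLen k - J else 0 := by
    rw [sum_ite_eq']
    split_ifs with h
    · rfl
    · rw [rowLen_eq_zero (not_lt.1 (mem_range.not.1 h)), Nat.zero_sub]
  rw [h1, truncSum, truncSum, ← sum_add_distrib]
  refine sum_congr rfl fun i _ => ?_
  simp only [straightPattern]
  by_cases hik : i = k
  · subst hik
    simp
  · split_ifs <;> omega

theorem isLattice_straightPattern (n : ℕ) : IsLattice n (kap.colLen 0) (straightPattern kap) := by
  intro J k _
  have := truncSum_straightPattern (kap := kap) J (k + 1)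
  have := truncSum_straightPattern (kap := kap) J k
  have := kap.rowLen_anti k (k + 1) (by omega)
  simp only [show k + 1 + 1 = k + 2 from rfl] at *
  omega

theorem patternWeight_straightPattern (k : Fin n) :
    patternWeight (kap.colLen 0) n (straightPattern kap) k = kap.rowLen k := by
  have := truncSum_straightPattern (kap := kap) 0 k
  simp only [truncSum, Nat.sub_zero] at this
  rw [patternWeight, rowSum, rowSum, this, Nat.add_sub_cancel_left]

theorem IsRowPattern.eq_straightPattern {g : ℕ → ℕ → ℕ} (hg : IsRowPattern n kap ⊥ g)
    (hlat : IsLattice n (kap.colLen 0) g) : g = straightPattern kap := by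
  have hzero : ∀ k i, k ≤ i → g k i = 0 := by
    intro k
    induction k with
    | zero => intro i _; rw [hg.zero, rowLen_bot]
    | succ k ih =>
      intro i hi
      obtain ⟨j, rfl⟩ : ∃ j, i = j + 1 := ⟨i - 1, by omega⟩
      have := hg.interlace k j
      have := ih j (by omega)
      omega
  -- If row `i` has an entry greater than `i`, let `J` be the first such column. There is no entry
  -- `i` from column `J` on, so by the lattice condition none of `i + 1, i + 2, …` either, although
  -- row `i` continues past `J`.
  have hfull : ∀ i, g (i + 1) i = kap.rowLen i := by
    intro i
    induction i using Nat.strong_induction_on with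
    | _ i ih =>
      by_contra hne
      have hlt : g (i + 1) i < kap.rowLen i := lt_of_le_of_ne (hg.le_rowLen _ _) hne
      have hin : i + 2 ≤ n := by
        by_contra hcon
        exact hne (hg.top _ (by omega) i)
      have hiL : i < kap.colLen 0 := by
        by_contra hcon
        rw [rowLen_eq_zero (not_lt.1 hcon)] at hlt
        omega
      set J := g (i + 1) i with hJ
      have hstart : truncSum (kap.colLen 0) g J (i + 1) = truncSum (kap.colLen 0) g J i := by
        refine sum_congr rfl fun j _ => ?_
        obtain h | rfl | h := lt_trichotomy j i
        · have h1 := hg.le_of_le j (show j + 1 ≤ i by omega)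
          have h2 := hg.mono i j
          have h3 := hg.le_rowLen (i + 1) j
          rw [ih j h] at h1
          omega
        · rw [hzero j j le_rfl]
          omega
        · rw [hzero (i + 1) j (by omega), hzero i j (by omega)]
      have hdec : ∀ m, i + m + 1 ≤ n →
          truncSum (kap.colLen 0) g J (i + m + 1) ≤ truncSum (kap.colLen 0) g J (i + m) := by
        intro m
        induction m with
        | zero => intro _; exact hstart.le
        | succ m ihm =>
          intro hm
          have h1 := ihm (by omega)
          have h2 := hlat J (i + m) (by omega)
          simp only [← add_assoc, show i + m + 1 + 1 = i + m + 2 from rfl] at *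
          omega
      have hle : ∀ m, i + m ≤ n →
          truncSum (kap.colLen 0) g J (i + m) ≤ truncSum (kap.colLen 0) g J i := by
        intro m
        induction m with
        | zero => intro _; exact le_rfl
        | succ m ihm => intro hm; exact (hdec m hm).trans (ihm (by omega))
      have h1 := hle (n - i) (by omega)
      rw [Nat.add_sub_cancel' (by omega)] at h1
      have h2 : truncSum (kap.colLen 0) g J i < truncSum (kap.colLen 0) g J n := by
        refine sum_lt_sum (fun j _ => Nat.sub_le_sub_right (hg.le_of_le j (by omega)) J)
          ⟨i, mem_range.2 hiL, ?_⟩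
        rw [hzero i i le_rfl, hg.top n le_rfl i]
        omega
      omega
  funext k i
  rw [straightPattern]
  split_ifs with h
  · have h1 := hg.le_of_le i (show i + 1 ≤ k by omega)
    have h2 := hg.le_rowLen k i
    rw [hfull] at h1
    omega
  · exact hzero k i (by omega)

theorem alternant_mul_schurPoly (h : kap.colLen 0 ≤ n) :
    alternant (staircase n) * schurPoly n kap =
      alternant (staircase n + fun k : Fin n => kap.rowLen k) := by
  classical
  rw [schurPoly, alternant_mul_skewSchurPoly bot_le, sum_eq_single (straightPattern kap)]
  · congr 2
    funext k
    exact patternWeight_straightPattern k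
  · intro g hg hne
    rw [mem_filter, mem_rowPatterns bot_le] at hg
    exact absurd (hg.1.eq_straightPattern hg.2) hne
  · intro hcon
    rw [mem_filter, mem_rowPatterns bot_le] at hcon
    exact absurd ⟨isRowPattern_straightPattern h, isLattice_straightPattern n⟩ hcon

end Straight

/-! ### Two lattice patterns with the same content -/

theorem strictAnti_staircase_add_rowLen (n : ℕ) (kap : YoungDiagram) :
    StrictAnti (staircase n + fun k : Fin n => kap.rowLen k) := by
  intro a b hab
  have h1 := kap.rowLen_anti a b (Fin.le_def.1 hab.le)
  have h2 := Fin.lt_def.1 hab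
  simp only [Pi.add_apply, staircase]
  omega

/-- After multiplication by the alternant, compare the coefficients of the exponent staircase plus
content. Lattice patterns contribute nonnegatively, and these two give at least `2`; in a Schur
expansion only one `κ` can match, with coefficient at most `1`. -/
theorem not_isMultiplicityFree_of_ne {n : ℕ} {lam mu : YoungDiagram} (hsub : mu ≤ lam)
    {g g' : ℕ → ℕ → ℕ} (hg : IsRowPattern n lam mu g) (hg' : IsRowPattern n lam mu g')
    (hlat : IsLattice n (lam.colLen 0) g) (hlat' : IsLattice n (lam.colLen 0) g') (hne : g ≠ g')
    (hwt : patternWeight (lam.colLen 0) n g = patternWeight (lam.colLen 0) n g') :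
    ¬ IsMultiplicityFree n lam mu := by
  classical
  rintro ⟨c, ⟨hc, hexp⟩, h01⟩
  set α := staircase n + patternWeight (lam.colLen 0) n g with hα
  have hαanti : StrictAnti α := hg.strictAnti_weight hlat
  have hcoeff := congrArg
    (fun f => (alternant (staircase n) * f).coeff (Finsupp.equivFunOnFinite.symm α)) hexp
  rw [alternant_mul_skewSchurPoly hsub, MvPolynomial.coeff_sum] at hcoeff
  have hleft : (2 : ℤ) ≤ ∑ f ∈ rowPatterns n lam mu with IsLattice n (lam.colLen 0) f,
      (alternant (staircase n + patternWeight (lam.colLen 0) n f)).coeff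
        (Finsupp.equivFunOnFinite.symm α) := by
    have h1 : ({g, g'} : Finset (ℕ → ℕ → ℕ)) ⊆
        ({f ∈ rowPatterns n lam mu | IsLattice n (lam.colLen 0) f}) := by
      intro f hf
      rw [mem_insert, mem_singleton] at hf
      rw [mem_filter, mem_rowPatterns hsub]
      obtain rfl | rfl := hf
      · exact ⟨hg, hlat⟩
      · exact ⟨hg', hlat'⟩
    refine le_trans ?_ (sum_le_sum_of_subset_of_nonneg h1 fun f hf _ => ?_)
    · rw [sum_pair hne, ← hwt, coeff_alternant hαanti hαanti, if_pos rfl]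
      norm_num
    · rw [mem_filter, mem_rowPatterns hsub] at hf
      rw [coeff_alternant hαanti (hf.1.strictAnti_weight hf.2)]
      split_ifs <;> norm_num
  rw [hcoeff, Finsupp.sum, mul_sum, MvPolynomial.coeff_sum] at hleft
  have hterm : ∀ κ ∈ c.support,
      (alternant (staircase n) * (c κ • schurPoly n κ)).coeff (Finsupp.equivFunOnFinite.symm α) =
        if (staircase n + fun k : Fin n => κ.rowLen k) = α then c κ else 0 := by
    intro κ hκ
    rw [mul_smul_comm, alternant_mul_schurPoly (hc κ (Finsupp.mem_support_iff.1 hκ)),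
      MvPolynomial.coeff_smul, coeff_alternant hαanti (strictAnti_staircase_add_rowLen n κ)]
    split_ifs <;> simp
  rw [sum_congr rfl hterm] at hleft
  by_cases hex : ∃ κ ∈ c.support, (staircase n + fun k : Fin n => κ.rowLen k) = α
  · obtain ⟨κ, hκ, hκα⟩ := hex
    rw [sum_eq_single_of_mem κ hκ, if_pos hκα] at hleft
    · obtain h | h := h01 κ <;> omega
    · intro κ' hκ' hne'
      refine if_neg fun hκα' => hne' (eq_of_rowLen_eq fun i => ?_)
      by_cases hi : i < n
      · have := congrFun (hκα'.trans hκα.symm) ⟨i, hi⟩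
        simpa using this
      · have h1 := hc κ (Finsupp.mem_support_iff.1 hκ)
        have h2 := hc κ' (Finsupp.mem_support_iff.1 hκ')
        rw [rowLen_eq_zero (by omega), rowLen_eq_zero (by omega)]
  · rw [sum_eq_zero fun κ hκ => if_neg fun h => hex ⟨κ, hκ, h⟩] at hleft
    norm_num at hleft

theorem truncSum_of_le {g : ℕ → ℕ → ℕ} {J m r L : ℕ} (hrL : r ≤ L) (h : ∀ i, r ≤ i → g m i ≤ J) :
    truncSum L g J m = truncSum r g J m := by
  refine (sum_subset (range_subset_range.2 hrL) fun i _ hi => ?_).symm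
  rw [mem_range, not_lt] at hi
  have := h i hi
  omega

theorem truncSum_add_mul {g : ℕ → ℕ → ℕ} {J m r : ℕ} (h : ∀ i < r, J ≤ g m i) :
    truncSum r g J m + r * J = rowSum r g m := by
  induction r with
  | zero => simp [truncSum, rowSum]
  | succ r ih =>
    have h1 := ih fun i hi => h i (by omega)
    have h2 := h r (by omega)
    simp only [truncSum, rowSum, sum_range_succ, add_mul] at *
    omega

/-- The lattice condition for the reading by rows implies the one for the reading by columns. -/
theorem IsRowPattern.isLattice_of_rowSum {n : ℕ} {lam mu : YoungDiagram} {g : ℕ → ℕ → ℕ}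
    (hg : IsRowPattern n lam mu g)
    (h : ∀ r k, k + 2 ≤ n →
      rowSum (r + 1) g (k + 2) + rowSum r g k ≤ rowSum r g (k + 1) + rowSum (r + 1) g (k + 1)) :
    IsLattice n (lam.colLen 0) g := by
  classical
  intro J k hk
  -- Let `s` rows of shape `k + 2` extend past column `J`. For `s = r + 1`, interlacing makes the
  -- first `r` rows of shape `k + 1` and the first `r - 1` rows of shape `k` reach `J`, so truncated
  -- sums turn into row sums, and the condition for row `r` applies.
  have hex : ∃ i, g (k + 2) i ≤ J := ⟨lam.colLen 0, by rw [hg.eq_zero _ le_rfl]; omega⟩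
  have hfind : ∀ i, i < Nat.find hex ↔ J < g (k + 2) i := fun i => by
    constructor
    · intro hi
      exact not_le.1 (Nat.find_min hex hi)
    · intro hi
      by_contra hcon
      have := hg.anti (k + 2) (not_lt.1 hcon)
      have := Nat.find_spec hex
      omega
  have hL : Nat.find hex ≤ lam.colLen 0 :=
    Nat.find_le (by rw [hg.eq_zero _ le_rfl]; omega)
  generalize Nat.find hex = s at *
  have hs2 : ∀ i, s ≤ i → g (k + 2) i ≤ J := fun i hi => by
    have := hfind i
    omega
  have hs1 : ∀ i, s ≤ i → g (k + 1) i ≤ J := fun i hi => (hg.mono _ _).trans (hs2 i hi)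
  have hs0 : ∀ i, s ≤ i → g k i ≤ J := fun i hi => (hg.mono _ _).trans (hs1 i hi)
  rw [truncSum_of_le hL hs2, truncSum_of_le hL hs1, truncSum_of_le hL hs0]
  cases s with
  | zero => simp [truncSum]
  | succ r =>
    have h2 := truncSum_add_mul (g := g) (J := J) (m := k + 2) (r := r + 1)
      fun i hi => ((hfind i).1 hi).le
    have hlt1 : ∀ i < r, J ≤ g (k + 1) i := fun i hi =>
      ((hfind (i + 1)).1 (by omega)).le.trans (hg.interlace (k + 1) i)
    have h1 := truncSum_add_mul hlt1
    have hr := h r k hk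
    have hw := hg.mono k r
    cases r with
    | zero => simp only [truncSum, rowSum, sum_range_succ, sum_range_zero] at *; omega
    | succ q =>
      have h0 := truncSum_add_mul (g := g) (J := J) (m := k) (r := q) fun i hi =>
        (hlt1 (i + 1) (by omega)).trans (hg.interlace k i)
      have hv := hg.interlace k q
      simp only [truncSum, rowSum, sum_range_succ, add_mul] at *
      omega

/-! ### Filling the columns independently -/

section Columns

variable {n : ℕ} {lam mu : YoungDiagram}

/-- `Y k` is the row in which the entries less than `k` of a column with `n` possible entries end;
the column occupies the rows from `t` to `b - 1`. -/
structure IsColumn (n t b : ℕ) (Y : ℕ → ℕ) : Prop where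
  zero : Y 0 = t
  top : ∀ k, n ≤ k → Y k = b
  mono : ∀ k, Y k ≤ Y (k + 1)
  step : ∀ k, Y (k + 1) ≤ Y k + 1

/-- The contribution of a column to the lattice condition for the entries `k`, `k + 1` and the
row `r`. -/
def latticeTerm (Y : ℕ → ℕ) (k r : ℕ) : ℤ :=
  if Y (k + 1) ≤ r then 2 * (Y (k + 1) : ℤ) - Y k - Y (k + 2) else 0

/-- The pattern that arises from a filling of the columns by sorting the rows. -/
def columnPattern (W : ℕ) (y : ℕ → ℕ → ℕ) (k i : ℕ) : ℕ :=
  ∑ j ∈ range W, if i < y j k then 1 else 0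

theorem rowSum_columnPattern (W : ℕ) (y : ℕ → ℕ → ℕ) (r k : ℕ) :
    rowSum r (columnPattern W y) k = ∑ j ∈ range W, min r (y j k) := by
  rw [rowSum]
  simp only [columnPattern]
  rw [sum_comm]
  refine sum_congr rfl fun j _ => ?_
  induction r with
  | zero => simp
  | succ r ih =>
    rw [sum_range_succ, ih]
    split_ifs <;> omega

theorem sum_lt_colLen {W : ℕ} {kap : YoungDiagram} {i : ℕ} (h : kap.rowLen i ≤ W) :
    (∑ j ∈ range W, if i < kap.colLen j then 1 else 0) = kap.rowLen i := by
  rw [← sum_filter, sum_const, smul_eq_mul, mul_one]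
  conv_rhs => rw [← card_range (kap.rowLen i)]
  congr 1
  ext j
  rw [mem_filter, mem_range, mem_range, ← YoungDiagram.mem_iff_lt_colLen,
    YoungDiagram.mem_iff_lt_rowLen]
  omega

theorem isRowPattern_columnPattern (hsub : mu ≤ lam) {y : ℕ → ℕ → ℕ}
    (hy : ∀ j < lam.rowLen 0, IsColumn n (mu.colLen j) (lam.colLen j) (y j)) :
    IsRowPattern n lam mu (columnPattern (lam.rowLen 0) y) where
  zero i := by
    rw [columnPattern, ← sum_lt_colLen (W := lam.rowLen 0)
      ((rowLen_mono hsub i).trans (lam.rowLen_anti 0 i (Nat.zero_le i)))]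
    exact sum_congr rfl fun j hj => by rw [(hy j (mem_range.1 hj)).zero]
  top k hk i := by
    rw [columnPattern, ← sum_lt_colLen (W := lam.rowLen 0) (lam.rowLen_anti 0 i (Nat.zero_le i))]
    exact sum_congr rfl fun j hj => by rw [(hy j (mem_range.1 hj)).top k hk]
  mono k i := sum_le_sum fun j hj => by
    have := (hy j (mem_range.1 hj)).mono k
    split_ifs <;> omega
  interlace k i := sum_le_sum fun j hj => by
    have := (hy j (mem_range.1 hj)).step k
    split_ifs <;> omega

/-- This is the number of entries `k` in the first `r` rows minus that of entries `k + 1` in the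
first `r + 1` rows. -/
theorem IsColumn.latticeTerm_eq {t b : ℕ} {Y : ℕ → ℕ} (h : IsColumn n t b Y) (k r : ℕ) :
    latticeTerm Y k r = min r (Y (k + 1)) + (min (r + 1) (Y (k + 1)) : ℕ) -
      (min (r + 1) (Y (k + 2)) : ℕ) - (min r (Y k) : ℕ) := by
  have h1 := h.mono k
  have h2 := h.mono (k + 1)
  have h3 := h.step k
  have h4 := h.step (k + 1)
  simp only [show k + 1 + 1 = k + 2 from rfl] at *
  rw [latticeTerm]
  split_ifs <;> omega

theorem isLattice_columnPattern (hsub : mu ≤ lam) {y : ℕ → ℕ → ℕ}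
    (hy : ∀ j < lam.rowLen 0, IsColumn n (mu.colLen j) (lam.colLen j) (y j))
    (hlat : ∀ k r, 0 ≤ ∑ j ∈ range (lam.rowLen 0), latticeTerm (y j) k r) :
    IsLattice n (lam.colLen 0) (columnPattern (lam.rowLen 0) y) := by
  refine (isRowPattern_columnPattern hsub hy).isLattice_of_rowSum fun r k _ => ?_
  have h := hlat k r
  rw [sum_congr rfl fun j hj => (hy j (mem_range.1 hj)).latticeTerm_eq k r] at h
  simp only [sum_sub_distrib, sum_add_distrib, ← Nat.cast_sum] at h
  simp only [rowSum_columnPattern]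
  omega

theorem IsColumn.le {t b : ℕ} {Y : ℕ → ℕ} (h : IsColumn n t b Y) (k : ℕ) : Y k ≤ b := by
  rw [← h.top (max k n) (le_max_right _ _)]
  exact monotone_nat_of_le_succ h.mono (le_max_left _ _)

/-- Sorting rows keeps the content, which `hsum` compares; `hne` detects that some row has different
entries, so that the sorted patterns differ. -/
theorem not_isMultiplicityFree_of_columns (hsub : mu ≤ lam) {y y' : ℕ → ℕ → ℕ}
    (hy : ∀ j < lam.rowLen 0, IsColumn n (mu.colLen j) (lam.colLen j) (y j))
    (hy' : ∀ j < lam.rowLen 0, IsColumn n (mu.colLen j) (lam.colLen j) (y' j))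
    (hlat : ∀ k r, 0 ≤ ∑ j ∈ range (lam.rowLen 0), latticeTerm (y j) k r)
    (hlat' : ∀ k r, 0 ≤ ∑ j ∈ range (lam.rowLen 0), latticeTerm (y' j) k r)
    (hsum : ∀ k, ∑ j ∈ range (lam.rowLen 0), y j k = ∑ j ∈ range (lam.rowLen 0), y' j k)
    (hne : ∃ k r, ∑ j ∈ range (lam.rowLen 0), min r (y j k) ≠
      ∑ j ∈ range (lam.rowLen 0), min r (y' j k)) :
    ¬ IsMultiplicityFree n lam mu := by
  refine not_isMultiplicityFree_of_ne hsub (isRowPattern_columnPattern hsub hy)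
    (isRowPattern_columnPattern hsub hy') (isLattice_columnPattern hsub hy hlat)
    (isLattice_columnPattern hsub hy' hlat') ?_ ?_
  · intro heq
    obtain ⟨k, r, h⟩ := hne
    rw [← rowSum_columnPattern, ← rowSum_columnPattern, heq] at h
    exact h rfl
  · have hmin : ∀ y : ℕ → ℕ → ℕ,
        (∀ j < lam.rowLen 0, IsColumn n (mu.colLen j) (lam.colLen j) (y j)) → ∀ k,
        rowSum (lam.colLen 0) (columnPattern (lam.rowLen 0) y) k =
          ∑ j ∈ range (lam.rowLen 0), y j k := fun y hy k => by
      rw [rowSum_columnPattern]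
      refine sum_congr rfl fun j hj => min_eq_right ?_
      exact ((hy j (mem_range.1 hj)).le k).trans (lam.colLen_anti 0 j (Nat.zero_le j))
    funext k
    rw [patternWeight, patternWeight, hmin y hy, hmin y hy, hmin y' hy', hmin y' hy', hsum, hsum]

/-! ### Runs of consecutive entries -/

/-- The column from row `t` to row `b - 1` with the entries `0, 1, 2, …`. -/
def stdColumn (t b k : ℕ) : ℕ := min (t + k) b

theorem isColumn_stdColumn {t b : ℕ} (h : t ≤ b) (hn : b - t ≤ n) :
    IsColumn n t b (stdColumn t b) := by
  constructor <;> intros <;> simp only [stdColumn] <;> omega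

/-- The contribution to the lattice condition of a maximal run of consecutive entries that ends
before the entry `e` and before the row `R`. -/
def runEnd (k r e R : ℕ) : ℤ := if k + 1 = e ∧ R ≤ r then 1 else 0

theorem runEnd_nonneg (k r e R : ℕ) : 0 ≤ runEnd k r e R := by
  unfold runEnd
  split_ifs <;> norm_num

/-- This is how starts are paid for: an end higher up counts for at least as many rows `r`. -/
theorem runEnd_le {R R' : ℕ} (h : R ≤ R') (k r e : ℕ) : runEnd k r e R' ≤ runEnd k r e R := by
  unfold runEnd
  split_ifs <;> omega

theorem latticeTerm_stdColumn {t b : ℕ} (h : t ≤ b) (k r : ℕ) :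
    latticeTerm (stdColumn t b) k r = runEnd k r (b - t) b := by
  simp only [latticeTerm, stdColumn, runEnd]
  split_ifs <;> omega

/-- The column from row `t` on with the entries from `[0, d)`, `[v, v + l)` and `[w, w + m)`. -/
def runColumn (t d v l w m k : ℕ) : ℕ := t + min k d + min (k - v) l + min (k - w) m

theorem isColumn_runColumn {t b d v l w m : ℕ} (hv : d ≤ v) (hw : v + l ≤ w) (hn : w + m ≤ n)
    (hb : t + d + l + m = b) : IsColumn n t b (runColumn t d v l w m) := by
  constructor <;> intros <;> simp only [runColumn] <;> omega

theorem second_difference_min (v l k : ℕ) :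
    2 * ((min (k + 1 - v) l : ℕ) : ℤ) - (min (k - v) l : ℕ) - (min (k + 2 - v) l : ℕ) =
      (if k + 1 = v + l then 1 else 0) - (if k + 1 = v then 1 else 0) := by
  split_ifs <;> omega

theorem ite_mul_ite_eq_runEnd {x k r e R : ℕ} (h : k + 1 = e → x = R) :
    (if x ≤ r then 1 else 0 : ℤ) * (if k + 1 = e then 1 else 0) = runEnd k r e R := by
  by_cases he : k + 1 = e
  · rw [h he]
    simp [runEnd, he]
  · simp [runEnd, he]

/-- Empty or adjacent runs are allowed: the superfluous ends and starts cancel. -/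
theorem latticeTerm_runColumn {t d v l w m : ℕ} (hv : d ≤ v) (hw : v + l ≤ w) (k r : ℕ) :
    latticeTerm (runColumn t d v l w m) k r =
      runEnd k r d (t + d) + runEnd k r (v + l) (t + d + l) + runEnd k r (w + m) (t + d + l + m) -
        runEnd k r v (t + d) - runEnd k r w (t + d + l) := by
  set x := runColumn t d v l w m (k + 1) with hx
  rw [runColumn] at hx
  rw [← ite_mul_ite_eq_runEnd (x := x) (by omega), ← ite_mul_ite_eq_runEnd (x := x) (by omega),
    ← ite_mul_ite_eq_runEnd (x := x) (by omega), ← ite_mul_ite_eq_runEnd (x := x) (by omega),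
    ← ite_mul_ite_eq_runEnd (x := x) (by omega)]
  have h1 := second_difference_min 0 d k
  have h2 := second_difference_min v l k
  have h3 := second_difference_min w m k
  rw [if_neg (Nat.succ_ne_zero k), Nat.zero_add] at h1
  simp only [Nat.sub_zero] at h1
  rw [latticeTerm, ← mul_add, ← mul_add, ← mul_sub, ← mul_sub, ite_mul, one_mul, zero_mul]
  refine if_congr Iff.rfl ?_ rfl
  simp only [runColumn, Nat.cast_add]
  linarith

theorem sum_update_update {α : Type*} [AddCommMonoid α] {W c₁ c₂ : ℕ} (h₁ : c₁ < W) (h₂ : c₂ < W)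
    (hne : c₁ ≠ c₂) (y : ℕ → ℕ → ℕ) (Y₁ Y₂ : ℕ → ℕ) (f : (ℕ → ℕ) → α) :
    ∑ j ∈ range W, f (Function.update (Function.update y c₁ Y₁) c₂ Y₂ j) =
      f Y₁ + f Y₂ + ∑ j ∈ (range W \ {c₁, c₂}), f (y j) := by
  have hsub : ({c₁, c₂} : Finset ℕ) ⊆ range W := by
    intro j hj
    rw [mem_insert, mem_singleton] at hj
    rw [mem_range]
    omega
  rw [← sum_sdiff hsub, add_comm, sum_pair hne]
  congr 1
  · rw [Function.update_of_ne hne, Function.update_self, Function.update_self]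
  · refine sum_congr rfl fun j hj => ?_
    rw [mem_sdiff, mem_insert, mem_singleton, not_or] at hj
    rw [Function.update_of_ne hj.2.2, Function.update_of_ne hj.2.1]

/-- If the two columns `c₁` and `c₂` can be filled in two ways, with the same entries but different
rows, so that with the standard filling of the columns in `H` the lattice condition holds, then
`s_{λ/μ}` is not multiplicity-free. -/
theorem not_isMultiplicityFree_of_two_columns (hsub : mu ≤ lam)
    (hstd : ∀ j < lam.rowLen 0, mu.colLen j ≤ lam.colLen j ∧ lam.colLen j - mu.colLen j ≤ n)
    {c₁ c₂ : ℕ} (h₁ : c₁ < lam.rowLen 0) (h₂ : c₂ < lam.rowLen 0) (hne : c₁ ≠ c₂)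
    {Y₁ Y₂ Y₁' Y₂' : ℕ → ℕ}
    (hY₁ : IsColumn n (mu.colLen c₁) (lam.colLen c₁) Y₁)
    (hY₂ : IsColumn n (mu.colLen c₂) (lam.colLen c₂) Y₂)
    (hY₁' : IsColumn n (mu.colLen c₁) (lam.colLen c₁) Y₁')
    (hY₂' : IsColumn n (mu.colLen c₂) (lam.colLen c₂) Y₂')
    {H : Finset ℕ} (hH : H ⊆ range (lam.rowLen 0) \ {c₁, c₂})
    (hlat : ∀ k r, 0 ≤ latticeTerm Y₁ k r + latticeTerm Y₂ k r +
      ∑ j ∈ H, runEnd k r (lam.colLen j - mu.colLen j) (lam.colLen j))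
    (hlat' : ∀ k r, 0 ≤ latticeTerm Y₁' k r + latticeTerm Y₂' k r +
      ∑ j ∈ H, runEnd k r (lam.colLen j - mu.colLen j) (lam.colLen j))
    (hsum : ∀ k, Y₁ k + Y₂ k = Y₁' k + Y₂' k)
    (hdiff : ∃ k r, min r (Y₁ k) + min r (Y₂ k) ≠ min r (Y₁' k) + min r (Y₂' k)) :
    ¬ IsMultiplicityFree n lam mu := by
  set std : ℕ → ℕ → ℕ := fun j => stdColumn (mu.colLen j) (lam.colLen j) with hstd_def
  have hcol : ∀ Z₁ Z₂, IsColumn n (mu.colLen c₁) (lam.colLen c₁) Z₁ →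
      IsColumn n (mu.colLen c₂) (lam.colLen c₂) Z₂ → ∀ j < lam.rowLen 0,
      IsColumn n (mu.colLen j) (lam.colLen j)
        (Function.update (Function.update std c₁ Z₁) c₂ Z₂ j) := by
    intro Z₁ Z₂ hZ₁ hZ₂ j hj
    by_cases hj₂ : j = c₂
    · subst hj₂
      rwa [Function.update_self]
    rw [Function.update_of_ne hj₂]
    by_cases hj₁ : j = c₁
    · subst hj₁
      rwa [Function.update_self]
    rw [Function.update_of_ne hj₁]
    exact isColumn_stdColumn (hstd j hj).1 (hstd j hj).2
  have hlattice : ∀ Z₁ Z₂ : ℕ → ℕ, (∀ k r, 0 ≤ latticeTerm Z₁ k r + latticeTerm Z₂ k r +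
      ∑ j ∈ H, runEnd k r (lam.colLen j - mu.colLen j) (lam.colLen j)) → ∀ k r,
      0 ≤ ∑ j ∈ range (lam.rowLen 0),
        latticeTerm (Function.update (Function.update std c₁ Z₁) c₂ Z₂ j) k r := by
    intro Z₁ Z₂ h k r
    rw [sum_update_update h₁ h₂ hne std Z₁ Z₂ fun Y => latticeTerm Y k r]
    refine (h k r).trans ?_
    gcongr
    have hterm : ∀ j ∈ range (lam.rowLen 0) \ {c₁, c₂}, latticeTerm (std j) k r =
        runEnd k r (lam.colLen j - mu.colLen j) (lam.colLen j) := fun j hj =>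
      latticeTerm_stdColumn (hstd j (mem_range.1 (mem_sdiff.1 hj).1)).1 k r
    rw [sum_congr rfl hterm]
    exact sum_le_sum_of_subset_of_nonneg hH fun j _ _ => runEnd_nonneg _ _ _ _
  refine not_isMultiplicityFree_of_columns hsub (hcol Y₁ Y₂ hY₁ hY₂) (hcol Y₁' Y₂' hY₁' hY₂')
    (hlattice Y₁ Y₂ hlat) (hlattice Y₁' Y₂' hlat') (fun k => ?_) ?_
  · rw [sum_update_update h₁ h₂ hne std Y₁ Y₂ fun Y => Y k,
      sum_update_update h₁ h₂ hne std Y₁' Y₂' fun Y => Y k, hsum]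
  · obtain ⟨k, r, h⟩ := hdiff
    refine ⟨k, r, ?_⟩
    rw [sum_update_update h₁ h₂ hne std Y₁ Y₂ fun Y => min r (Y k),
      sum_update_update h₁ h₂ hne std Y₁' Y₂' fun Y => min r (Y k)]
    omega

end Columns

/-- Two adjacent runs count like one; this and the next identity show that an exchange preserves the
content. -/
theorem min_add_min_sub (k a b : ℕ) : min k a + min (k - a) b = min k (a + b) := by omega

theorem min_sub_add_min_sub (k v a b : ℕ) :
    min (k - v) a + min (k - (v + a)) b = min (k - v) (a + b) := by omega

/-! ### Three configurations of columns -/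

section Configurations

variable {n : ℕ} {lam mu : YoungDiagram}

/-- From the first filling to the second, `s` moves from `c₂` to `c₁` and `z + u` moves back. The
start `z` in `c₂` is paid for by `c₃`, the later starts in `c₁` by the ends of runs in `c₂`. -/
theorem not_isMultiplicityFree_of_steps_aux (hsub : mu ≤ lam)
    (hstd : ∀ j < lam.rowLen 0, mu.colLen j ≤ lam.colLen j ∧ lam.colLen j - mu.colLen j ≤ n)
    {c₁ c₂ c₃ : ℕ} (h₁₂ : c₁ < c₂) (h₂₃ : c₂ < c₃) (h₃ : c₃ < lam.rowLen 0)
    {t₁ t₂ b₁ b₂ b₃ z : ℕ}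
    (ht₁ : mu.colLen c₁ = t₁) (ht₂ : mu.colLen c₂ = t₂) (hb₁ : lam.colLen c₁ = b₁)
    (hb₂ : lam.colLen c₂ = b₂) (hb₃ : lam.colLen c₃ = b₃) (hz : lam.colLen c₃ - mu.colLen c₃ = z)
    {s u l x y : ℕ} (e1 : s + 1 ≤ z) (e2 : l ≤ s) (e3 : s + 1 + x ≤ z + u)
    (e4 : z + u + y + 1 ≤ n) (e5 : t₂ + s + 1 + u = b₂) (e6 : t₁ + l + x + y + 1 = b₁)
    (e7 : b₃ ≤ t₂ + s) (e8 : t₂ + s + 1 ≤ t₁ + l) (e9 : b₂ ≤ t₁ + l + x) :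
    ¬ IsMultiplicityFree n lam mu := by
  refine not_isMultiplicityFree_of_two_columns hsub hstd (by omega : c₁ < _) (by omega : c₂ < _)
    (by omega) (Y₁ := runColumn t₁ l (s + 1) x (z + u) (y + 1))
    (Y₂ := runColumn t₂ (s + 1) z u (z + u) 0)
    (Y₁' := runColumn t₁ l s (x + 1) (z + u + 1) y)
    (Y₂' := runColumn t₂ s z (u + 1) (z + u + 1) 0) ?_ ?_ ?_ ?_ (H := {c₃}) ?_ ?_ ?_ ?_ ?_
  · rw [ht₁, hb₁]
    exact isColumn_runColumn (by omega) (by omega) (by omega) (by omega)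
  · rw [ht₂, hb₂]
    exact isColumn_runColumn (by omega) (by omega) (by omega) (by omega)
  · rw [ht₁, hb₁]
    exact isColumn_runColumn (by omega) (by omega) (by omega) (by omega)
  · rw [ht₂, hb₂]
    exact isColumn_runColumn (by omega) (by omega) (by omega) (by omega)
  · simp only [singleton_subset_iff, mem_sdiff, mem_range, mem_insert, mem_singleton]
    omega
  · intro k r
    rw [sum_singleton, hz, hb₃, latticeTerm_runColumn (by omega) (by omega),
      latticeTerm_runColumn (by omega) (by omega)]
    have m1 := runEnd_le (show b₃ ≤ t₂ + (s + 1) by omega) k r z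
    have m2 := runEnd_le (show t₂ + (s + 1) ≤ t₁ + l by omega) k r (s + 1)
    have m3 := runEnd_le (show t₂ + (s + 1) + u + 0 ≤ t₁ + l + x by omega) k r (z + u)
    have p1 := runEnd_nonneg k r l (t₁ + l)
    have p2 := runEnd_nonneg k r (s + 1 + x) (t₁ + l + x)
    have p3 := runEnd_nonneg k r (z + u + (y + 1)) (t₁ + l + x + (y + 1))
    simp only [add_zero] at *
    linarith
  · intro k r
    rw [sum_singleton, hz, hb₃, latticeTerm_runColumn (by omega) (by omega),
      latticeTerm_runColumn (by omega) (by omega)]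
    have m1 := runEnd_le (show b₃ ≤ t₂ + s by omega) k r z
    have m2 := runEnd_le (show t₂ + s ≤ t₁ + l by omega) k r s
    have m3 := runEnd_le (show t₂ + s + (u + 1) + 0 ≤ t₁ + l + (x + 1) by omega) k r (z + u + 1)
    have p1 := runEnd_nonneg k r l (t₁ + l)
    have p2 := runEnd_nonneg k r (s + (x + 1)) (t₁ + l + (x + 1))
    have p3 := runEnd_nonneg k r (z + u + 1 + y) (t₁ + l + (x + 1) + y)
    simp only [add_zero, ← add_assoc] at *
    linarith
  · intro k
    have a1 := min_add_min_sub k (s + 1) x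
    have a2 := min_add_min_sub k s (x + 1)
    have a3 := min_sub_add_min_sub k z u (y + 1)
    have a4 := min_sub_add_min_sub k z (u + 1) y
    simp only [runColumn, Nat.min_zero, show s + 1 + x = s + (x + 1) by omega,
      show u + 1 + y = u + (y + 1) by omega, ← add_assoc] at *
    omega
  -- Up to this row `c₁` has only entries at most `s` in both fillings, so just the missing `s` in
  -- `c₂` is visible.
  · refine ⟨s + 1, t₂ + s + 1, ?_⟩
    simp only [runColumn]
    omega

/-- Three columns such that both ends move strictly up from each one to the next one. -/
theorem not_isMultiplicityFree_of_steps (hsub : mu ≤ lam)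
    (hlt : ∀ j < lam.rowLen 0, mu.colLen j < lam.colLen j)
    (hn : ∀ j < lam.rowLen 0, lam.colLen j - mu.colLen j < n)
    {c₁ c₂ c₃ : ℕ} (h₁₂ : c₁ < c₂) (h₂₃ : c₂ < c₃) (h₃ : c₃ < lam.rowLen 0)
    (ht₁₂ : mu.colLen c₂ < mu.colLen c₁) (ht₂₃ : mu.colLen c₃ < mu.colLen c₂)
    (hb₁₂ : lam.colLen c₂ < lam.colLen c₁) (hb₂₃ : lam.colLen c₃ < lam.colLen c₂) :
    ¬ IsMultiplicityFree n lam mu := by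
  have hl₁ := hlt c₁ (by omega)
  have hl₂ := hlt c₂ (by omega)
  have hl₃ := hlt c₃ h₃
  have hn₁ := hn c₁ (by omega)
  have hn₂ := hn c₂ (by omega)
  have hn₃ := hn c₃ h₃
  -- In all cases `c₂` is first filled with `0, 1, 2, …`, and `c₁` likewise except that the smallest
  -- of the three heights minus one is replaced by the largest height. The latter is an allowed
  -- entry because it is less than `n`.
  have key : ∀ t₁ t₂ t₃ b₁ b₂ b₃ h₁ h₂ h₃ : ℕ, t₁ + h₁ = b₁ → t₂ + h₂ = b₂ → t₃ + h₃ = b₃ →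
      0 < h₁ → 0 < h₂ → 0 < h₃ → h₁ < n → h₂ < n → h₃ < n → t₂ < t₁ → t₃ < t₂ → b₂ < b₁ → b₃ < b₂ →
      ∃ s u l x y : ℕ, s + 1 ≤ h₃ ∧ l ≤ s ∧ s + 1 + x ≤ h₃ + u ∧ h₃ + u + y + 1 ≤ n ∧
        t₂ + s + 1 + u = b₂ ∧ t₁ + l + x + y + 1 = b₁ ∧ b₃ ≤ t₂ + s ∧ t₂ + s + 1 ≤ t₁ + l ∧
        b₂ ≤ t₁ + l + x := by
    intro t₁ t₂ t₃ b₁ b₂ b₃ h₁ h₂ h₃ _ _ _ _ _ _ _ _ _ _ _ _ _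
    obtain h | h := le_total h₂ h₃
    · obtain h' | h' := le_total h₁ h₂
      · exact ⟨h₂ - 1, 0, h₁ - 1, 0, 0, by omega⟩
      obtain h'' | h'' := le_total h₁ h₃
      · exact ⟨h₂ - 1, 0, h₂ - 1, h₁ - h₂, 0, by omega⟩
      · exact ⟨h₂ - 1, 0, h₂ - 1, h₃ - h₂, h₁ - h₃, by omega⟩
    · obtain h' | h' := le_total h₁ h₃
      · exact ⟨h₃ - 1, h₂ - h₃, h₁ - 1, 0, 0, by omega⟩
      obtain h'' | h'' := le_total h₁ h₂
      · exact ⟨h₃ - 1, h₂ - h₃, h₃ - 1, h₁ - h₃, 0, by omega⟩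
      · exact ⟨h₃ - 1, h₂ - h₃, h₃ - 1, h₂ - h₃, h₁ - h₂, by omega⟩
  obtain ⟨s, u, l, x, y, e1, e2, e3, e4, e5, e6, e7, e8, e9⟩ :=
    key (mu.colLen c₁) (mu.colLen c₂) (mu.colLen c₃) (lam.colLen c₁) (lam.colLen c₂)
      (lam.colLen c₃) (lam.colLen c₁ - mu.colLen c₁) (lam.colLen c₂ - mu.colLen c₂)
      (lam.colLen c₃ - mu.colLen c₃) (by omega) (by omega) (by omega) (by omega) (by omega)
      (by omega) hn₁ hn₂ hn₃ ht₁₂ ht₂₃ hb₁₂ hb₂₃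
  exact not_isMultiplicityFree_of_steps_aux hsub (fun j hj => ⟨(hlt j hj).le, (hn j hj).le⟩)
    h₁₂ h₂₃ h₃ rfl rfl rfl rfl rfl rfl e1 e2 e3 e4 e5 e6 e7 e8 e9

/-- Here `c₃` and `c₄` pay for the starts `z₂` and `z₁` in `c₂`, whose ends pay for `c₁`. The
exchange moves `z₂ + b` from `c₂` to `c₁` and `z₁ + a` back. -/
theorem not_isMultiplicityFree_of_straight_rotated_aux (hsub : mu ≤ lam)
    (hstd : ∀ j < lam.rowLen 0, mu.colLen j ≤ lam.colLen j ∧ lam.colLen j - mu.colLen j ≤ n)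
    {c₁ c₂ c₃ c₄ : ℕ} (h₁₂ : c₁ < c₂) (h₂₃ : c₂ < c₃) (h₃₄ : c₃ < c₄) (h₄ : c₄ < lam.rowLen 0)
    {t b₁ b₂ z₁ z₂ : ℕ} (ht₁ : mu.colLen c₁ = t) (ht₂ : mu.colLen c₂ = t)
    (hb₁ : lam.colLen c₁ = b₁) (hb₂ : lam.colLen c₂ = b₂) (hb₃ : lam.colLen c₃ = z₁)
    (hb₄ : lam.colLen c₄ = z₁) (hz₃ : lam.colLen c₃ - mu.colLen c₃ = z₂) (ht₄ : mu.colLen c₄ = 0)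
    {d b a m c g : ℕ} (e1 : d ≤ z₂) (e2 : z₂ + b + 1 ≤ z₁) (e3 : m ≤ z₂ + b)
    (e4 : z₂ + b + 1 + c ≤ z₁ + a) (e5 : z₁ + a + g + 1 ≤ n) (e6 : t + d + b + 1 + a = b₂)
    (e7 : t + m + c + g + 1 = b₁) (e8 : z₁ ≤ t) (e9 : d + b + 1 ≤ m)
    (e10 : d + b + 1 + a ≤ m + c) : ¬ IsMultiplicityFree n lam mu := by
  refine not_isMultiplicityFree_of_two_columns hsub hstd (by omega : c₁ < _) (by omega : c₂ < _)
    (by omega) (Y₁ := runColumn t m (z₂ + b + 1) c (z₁ + a) (g + 1))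
    (Y₂ := runColumn t d z₂ (b + 1) z₁ a)
    (Y₁' := runColumn t m (z₂ + b) (c + 1) (z₁ + a + 1) g)
    (Y₂' := runColumn t d z₂ b z₁ (a + 1)) ?_ ?_ ?_ ?_ (H := {c₃, c₄}) ?_ ?_ ?_ ?_ ?_
  · rw [ht₁, hb₁]
    exact isColumn_runColumn (by omega) (by omega) (by omega) (by omega)
  · rw [ht₂, hb₂]
    exact isColumn_runColumn (by omega) (by omega) (by omega) (by omega)
  · rw [ht₁, hb₁]
    exact isColumn_runColumn (by omega) (by omega) (by omega) (by omega)
  · rw [ht₂, hb₂]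
    exact isColumn_runColumn (by omega) (by omega) (by omega) (by omega)
  · simp only [insert_subset_iff, singleton_subset_iff, mem_sdiff, mem_range, mem_insert,
      mem_singleton]
    omega
  · intro k r
    rw [sum_pair (by omega), hz₃, hb₃, hb₄, ht₄, Nat.sub_zero,
      latticeTerm_runColumn (by omega) (by omega), latticeTerm_runColumn (by omega) (by omega)]
    have m1 := runEnd_le (show z₁ ≤ t + d by omega) k r z₂
    have m2 := runEnd_le (show z₁ ≤ t + d + (b + 1) by omega) k r z₁
    have m3 := runEnd_le (show t + d + (b + 1) ≤ t + m by omega) k r (z₂ + (b + 1))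
    have m4 := runEnd_le (show t + d + (b + 1) + a ≤ t + m + c by omega) k r (z₁ + a)
    have p1 := runEnd_nonneg k r d (t + d)
    have p2 := runEnd_nonneg k r m (t + m)
    have p3 := runEnd_nonneg k r (z₂ + b + 1 + c) (t + m + c)
    have p4 := runEnd_nonneg k r (z₁ + a + (g + 1)) (t + m + c + (g + 1))
    simp only [← add_assoc] at *
    linarith
  · intro k r
    rw [sum_pair (by omega), hz₃, hb₃, hb₄, ht₄, Nat.sub_zero,
      latticeTerm_runColumn (by omega) (by omega), latticeTerm_runColumn (by omega) (by omega)]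
    have m1 := runEnd_le (show z₁ ≤ t + d by omega) k r z₂
    have m2 := runEnd_le (show z₁ ≤ t + d + b by omega) k r z₁
    have m3 := runEnd_le (show t + d + b ≤ t + m by omega) k r (z₂ + b)
    have m4 := runEnd_le (show t + d + b + (a + 1) ≤ t + m + (c + 1) by omega) k r (z₁ + (a + 1))
    have p1 := runEnd_nonneg k r d (t + d)
    have p2 := runEnd_nonneg k r m (t + m)
    have p3 := runEnd_nonneg k r (z₂ + b + (c + 1)) (t + m + (c + 1))
    have p4 := runEnd_nonneg k r (z₁ + a + 1 + g) (t + m + (c + 1) + g)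
    simp only [← add_assoc] at *
    linarith
  · intro k
    have a1 := min_sub_add_min_sub k z₂ (b + 1) c
    have a2 := min_sub_add_min_sub k z₂ b (c + 1)
    have a3 := min_sub_add_min_sub k z₁ a (g + 1)
    have a4 := min_sub_add_min_sub k z₁ (a + 1) g
    simp only [runColumn, show b + 1 + c = b + (c + 1) by omega,
      show a + 1 + g = a + (g + 1) by omega, ← add_assoc] at *
    omega
  · refine ⟨z₂ + b + 1, t + d + b + 1, ?_⟩
    simp only [runColumn]
    omega

/-- Two columns with the same top, and above them two columns with the same bottom. -/
theorem not_isMultiplicityFree_of_straight_rotated (hsub : mu ≤ lam)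
    (hlt : ∀ j < lam.rowLen 0, mu.colLen j < lam.colLen j)
    (hn : ∀ j < lam.rowLen 0, lam.colLen j - mu.colLen j < n)
    {c₁ c₂ c₃ c₄ : ℕ} (h₁₂ : c₁ < c₂) (h₂₃ : c₂ < c₃) (h₃₄ : c₃ < c₄) (h₄ : c₄ < lam.rowLen 0)
    (ht₁₂ : mu.colLen c₁ = mu.colLen c₂) (ht₃ : 0 < mu.colLen c₃) (ht₄ : mu.colLen c₄ = 0)
    (hb₁₂ : lam.colLen c₂ < lam.colLen c₁) (hb₃₄ : lam.colLen c₃ = lam.colLen c₄)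
    (hbt : lam.colLen c₄ ≤ mu.colLen c₁) : ¬ IsMultiplicityFree n lam mu := by
  have hl₂ := hlt c₂ (by omega)
  have hl₃ := hlt c₃ (by omega)
  have hn₁ := hn c₁ (by omega)
  have hn₄ := hn c₄ h₄
  have key : ∀ z₁ z₂ h₁ h₂ : ℕ, 0 < z₂ → z₂ < z₁ → 0 < h₂ → h₂ < h₁ → z₁ < n → h₁ < n →
      ∃ d b a m c g : ℕ, d ≤ z₂ ∧ z₂ + b + 1 ≤ z₁ ∧ m ≤ z₂ + b ∧ z₂ + b + 1 + c ≤ z₁ + a ∧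
        z₁ + a + g + 1 ≤ n ∧ d + b + 1 + a = h₂ ∧ m + c + g + 1 = h₁ ∧ d + b + 1 ≤ m ∧
        d + b + 1 + a ≤ m + c := by
    intro z₁ z₂ h₁ h₂ _ _ _ _ _ _
    obtain h | h := le_or_gt h₁ z₁
    -- The maximum is the least admissible `m`: the first run of `c₁` must cover `h₂` rows, and its
    -- second run must end before `z₁`.
    · obtain h' | h' := le_total h₂ z₂
      · exact ⟨h₂ - 1, 0, 0, max h₂ (h₁ + z₂ - z₁), h₁ - 1 - max h₂ (h₁ + z₂ - z₁), 0, by omega⟩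
      · exact ⟨z₂ - 1, h₂ - z₂, 0, max h₂ (h₁ + h₂ - z₁), h₁ - 1 - max h₂ (h₁ + h₂ - z₁), 0,
          by omega⟩
    · obtain h' | h' := lt_or_ge h₂ z₁
      · obtain h'' | h'' := le_total h₂ z₂
        · exact ⟨h₂ - 1, 0, 0, z₂, z₁ - z₂ - 1, h₁ - z₁, by omega⟩
        · exact ⟨z₂ - 1, h₂ - z₂, 0, h₂, z₁ - h₂ - 1, h₁ - z₁, by omega⟩
      · exact ⟨z₂ - 1, z₁ - 1 - z₂, h₂ + 1 - z₁, z₁ - 1, h₂ + 1 - z₁, h₁ - h₂ - 1, by omega⟩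
  obtain ⟨d, b, a, m, c, g, e1, e2, e3, e4, e5, e6, e7, e9, e10⟩ :=
    key (lam.colLen c₄) (lam.colLen c₃ - mu.colLen c₃) (lam.colLen c₁ - mu.colLen c₁)
      (lam.colLen c₂ - mu.colLen c₂) (by omega) (by omega) (by omega) (by omega) (by omega)
      (by omega)
  exact not_isMultiplicityFree_of_straight_rotated_aux hsub
    (fun j hj => ⟨(hlt j hj).le, (hn j hj).le⟩) h₁₂ h₂₃ h₃₄ h₄ rfl ht₁₂.symm rfl rfl hb₃₄ rfl rfl
    ht₄ e1 e2 e3 e4 e5 (by omega) (by omega) hbt e9 e10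

/-- Now `c₄` and `c₃` pay for the starts `z₂` and `z₁` in `c₂`. The exchange moves `d` from `c₂` to
`c₁` and `z₂ + b` back, while the last run of `c₂` stays. -/
theorem not_isMultiplicityFree_of_rotated_straight_aux (hsub : mu ≤ lam)
    (hstd : ∀ j < lam.rowLen 0, mu.colLen j ≤ lam.colLen j ∧ lam.colLen j - mu.colLen j ≤ n)
    {c₁ c₂ c₃ c₄ : ℕ} (h₁₂ : c₁ < c₂) (h₂₃ : c₂ < c₃) (h₃₄ : c₃ < c₄) (h₄ : c₄ < lam.rowLen 0)
    {t₁ t₂ B z₁ z₂ : ℕ} (ht₁ : mu.colLen c₁ = t₁) (ht₂ : mu.colLen c₂ = t₂)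
    (hb₁ : lam.colLen c₁ = B) (hb₂ : lam.colLen c₂ = B) (hb₃ : lam.colLen c₃ = z₁)
    (hb₄ : lam.colLen c₄ = z₂) (ht₃ : mu.colLen c₃ = 0) (ht₄ : mu.colLen c₄ = 0)
    {d b a f e c : ℕ} (e1 : d + 1 ≤ z₂) (e2 : z₂ + b + 1 ≤ z₁) (e3 : z₁ + a ≤ n)
    (e4 : t₂ + d + 1 + b + a = B) (e5 : f ≤ d) (e6 : d + 1 + e ≤ z₂ + b)
    (e7 : z₂ + b + c + 1 ≤ z₁ + a) (e8 : t₁ + f + e + c + 1 = B) (e9 : z₂ ≤ t₂ + d)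
    (e10 : z₁ ≤ t₂ + d + 1 + b) (e11 : t₂ + d + 1 ≤ t₁ + f)
    (e12 : t₂ + d + 1 + b ≤ t₁ + f + e) : ¬ IsMultiplicityFree n lam mu := by
  refine not_isMultiplicityFree_of_two_columns hsub hstd (by omega : c₁ < _) (by omega : c₂ < _)
    (by omega) (Y₁ := runColumn t₁ f (d + 1) e (z₂ + b) (c + 1))
    (Y₂ := runColumn t₂ (d + 1) z₂ b z₁ a)
    (Y₁' := runColumn t₁ f d (e + 1) (z₂ + b + 1) c)
    (Y₂' := runColumn t₂ d z₂ (b + 1) z₁ a) ?_ ?_ ?_ ?_ (H := {c₃, c₄}) ?_ ?_ ?_ ?_ ?_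
  · rw [ht₁, hb₁]
    exact isColumn_runColumn (by omega) (by omega) (by omega) (by omega)
  · rw [ht₂, hb₂]
    exact isColumn_runColumn (by omega) (by omega) (by omega) (by omega)
  · rw [ht₁, hb₁]
    exact isColumn_runColumn (by omega) (by omega) (by omega) (by omega)
  · rw [ht₂, hb₂]
    exact isColumn_runColumn (by omega) (by omega) (by omega) (by omega)
  · simp only [insert_subset_iff, singleton_subset_iff, mem_sdiff, mem_range, mem_insert,
      mem_singleton]
    omega
  · intro k r
    rw [sum_pair (by omega), hb₃, hb₄, ht₃, ht₄, Nat.sub_zero, Nat.sub_zero,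
      latticeTerm_runColumn (by omega) (by omega), latticeTerm_runColumn (by omega) (by omega)]
    have m1 := runEnd_le (show z₂ ≤ t₂ + (d + 1) by omega) k r z₂
    have m2 := runEnd_le (show z₁ ≤ t₂ + (d + 1) + b by omega) k r z₁
    have m3 := runEnd_le (show t₂ + (d + 1) ≤ t₁ + f by omega) k r (d + 1)
    have m4 := runEnd_le (show t₂ + (d + 1) + b ≤ t₁ + f + e by omega) k r (z₂ + b)
    have p1 := runEnd_nonneg k r f (t₁ + f)
    have p2 := runEnd_nonneg k r (d + 1 + e) (t₁ + f + e)
    have p3 := runEnd_nonneg k r (z₂ + b + (c + 1)) (t₁ + f + e + (c + 1))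
    have p4 := runEnd_nonneg k r (z₁ + a) (t₂ + (d + 1) + b + a)
    simp only [← add_assoc] at *
    linarith
  · intro k r
    rw [sum_pair (by omega), hb₃, hb₄, ht₃, ht₄, Nat.sub_zero, Nat.sub_zero,
      latticeTerm_runColumn (by omega) (by omega), latticeTerm_runColumn (by omega) (by omega)]
    have m1 := runEnd_le (show z₂ ≤ t₂ + d by omega) k r z₂
    have m2 := runEnd_le (show z₁ ≤ t₂ + d + (b + 1) by omega) k r z₁
    have m3 := runEnd_le (show t₂ + d ≤ t₁ + f by omega) k r d
    have m4 := runEnd_le (show t₂ + d + (b + 1) ≤ t₁ + f + (e + 1) by omega) k r (z₂ + (b + 1))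
    have p1 := runEnd_nonneg k r f (t₁ + f)
    have p2 := runEnd_nonneg k r (d + (e + 1)) (t₁ + f + (e + 1))
    have p3 := runEnd_nonneg k r (z₂ + b + 1 + c) (t₁ + f + (e + 1) + c)
    have p4 := runEnd_nonneg k r (z₁ + a) (t₂ + d + (b + 1) + a)
    simp only [← add_assoc] at *
    linarith
  · intro k
    have a1 := min_add_min_sub k (d + 1) e
    have a2 := min_add_min_sub k d (e + 1)
    have a3 := min_sub_add_min_sub k z₂ b (c + 1)
    have a4 := min_sub_add_min_sub k z₂ (b + 1) c
    simp only [runColumn, show d + 1 + e = d + (e + 1) by omega,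
      show b + 1 + c = b + (c + 1) by omega, ← add_assoc] at *
    omega
  · refine ⟨d + 1, t₂ + d + 1, ?_⟩
    simp only [runColumn]
    omega

/-- Two columns with the same bottom, and to the right of them two columns that begin in the top
row, such that no row between them is empty. -/
theorem not_isMultiplicityFree_of_rotated_straight (hsub : mu ≤ lam)
    (hlt : ∀ j < lam.rowLen 0, mu.colLen j < lam.colLen j)
    (hn : ∀ j < lam.rowLen 0, lam.colLen j - mu.colLen j < n)
    {c₁ c₂ c₃ c₄ : ℕ} (h₁₂ : c₁ < c₂) (h₂₃ : c₂ < c₃) (h₃₄ : c₃ < c₄) (h₄ : c₄ < lam.rowLen 0)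
    (ht₁₂ : mu.colLen c₂ < mu.colLen c₁) (ht₂ : 0 < mu.colLen c₂) (ht₃ : mu.colLen c₃ = 0)
    (ht₄ : mu.colLen c₄ = 0) (hb₁₂ : lam.colLen c₁ = lam.colLen c₂)
    (hb₂₃ : lam.colLen c₃ < lam.colLen c₂) (hb₃₄ : lam.colLen c₄ < lam.colLen c₃)
    (htb : mu.colLen c₂ ≤ lam.colLen c₃) : ¬ IsMultiplicityFree n lam mu := by
  have hl₁ := hlt c₁ (by omega)
  have hl₄ := hlt c₄ h₄
  have hn₂ := hn c₂ (by omega)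
  have hn₃ := hn c₃ (by omega)
  have key : ∀ t₁ t₂ B z₁ z₂ : ℕ, 0 < t₂ → t₂ < t₁ → t₁ < B → 0 < z₂ → z₂ < z₁ → z₁ < B → t₂ ≤ z₁ →
      z₁ < n → B - t₂ < n → ∃ d b a f e c : ℕ, d + 1 ≤ z₂ ∧ z₂ + b + 1 ≤ z₁ ∧ z₁ + a ≤ n ∧
        t₂ + d + 1 + b + a = B ∧ f ≤ d ∧ d + 1 + e ≤ z₂ + b ∧ z₂ + b + c + 1 ≤ z₁ + a ∧
        t₁ + f + e + c + 1 = B ∧ z₂ ≤ t₂ + d ∧ z₁ ≤ t₂ + d + 1 + b ∧ t₂ + d + 1 ≤ t₁ + f ∧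
        t₂ + d + 1 + b ≤ t₁ + f + e := by
    intro t₁ t₂ B z₁ z₂ _ _ _ _ _ _ _ _ _
    obtain ⟨h₂, rfl⟩ := Nat.exists_eq_add_of_le (show t₂ ≤ B by omega)
    obtain ⟨h₁, hh₁⟩ := Nat.exists_eq_add_of_le (show t₁ ≤ t₂ + h₂ by omega)
    -- The last run of `c₂` is chosen to end with the entry `max z₁ h₂`, which is less than `n`.
    obtain h | h := le_or_gt h₂ z₁
    · obtain h' | h' := le_total (h₂ + z₂) (z₁ + 1)
      · exact ⟨0, h₂ - 2, 1, 0, h₁ - 1, 0, by omega⟩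
      · obtain h'' | h'' := le_total (h₁ - 1) (z₁ - z₂ - 1)
        · exact ⟨h₂ + z₂ - z₁ - 1, z₁ - z₂ - 1, 1, 0, h₁ - 1, 0, by omega⟩
        · exact ⟨h₂ + z₂ - z₁ - 1, z₁ - z₂ - 1, 1, h₁ - (z₁ - z₂), z₁ - z₂ - 1, 0, by omega⟩
    · obtain h' | h' := le_total (h₁ + 1) z₁
      · obtain h'' | h'' := le_total (h₁ - 1) (z₁ - z₂ - 1)
        · exact ⟨z₂ - 1, z₁ - z₂ - 1, h₂ + 1 - z₁, 0, h₁ - 1, 0, by omega⟩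
        · exact ⟨z₂ - 1, z₁ - z₂ - 1, h₂ + 1 - z₁, h₁ - (z₁ - z₂), z₁ - z₂ - 1, 0, by omega⟩
      · exact ⟨z₂ - 1, z₁ - z₂ - 1, h₂ + 1 - z₁, z₂ - 1, z₁ - z₂ - 1, h₁ + 1 - z₁, by omega⟩
  obtain ⟨d, b, a, f, e, c, e1, e2, e3, e4, e5, e6, e7, e8, e9, e10, e11, e12⟩ :=
    key (mu.colLen c₁) (mu.colLen c₂) (lam.colLen c₂) (lam.colLen c₃) (lam.colLen c₄) ht₂ ht₁₂
      (by omega) (by omega) hb₃₄ hb₂₃ htb (by omega) (by omega)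
  exact not_isMultiplicityFree_of_rotated_straight_aux hsub
    (fun j hj => ⟨(hlt j hj).le, (hn j hj).le⟩) h₁₂ h₂₃ h₃₄ h₄ rfl rfl hb₁₂ rfl rfl rfl ht₃ ht₄
    e1 e2 e3 e4 e5 e6 e7 e8 e9 e10 e11 e12

end Configurations

/-! ### Finding the columns -/

section Hypotheses

variable {n : ℕ} {lam mu : YoungDiagram}

theorem mem_skewCells_iff_colLen {i c : ℕ} :
    (i, c) ∈ skewCells lam mu ↔ mu.colLen c ≤ i ∧ i < lam.colLen c := by
  simp only [skewCells, mem_sdiff, YoungDiagram.mem_cells, YoungDiagram.mem_iff_lt_colLen]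
  omega

theorem colSize_eq (k : ℕ) : colSize lam mu k = lam.colLen k - mu.colLen k := by
  have h : {a ∈ skewCells lam mu | a.2 = k} = Ico (mu.colLen k) (lam.colLen k) ×ˢ {k} := by
    ext ⟨i, c⟩
    rw [mem_filter, mem_product, mem_Ico, mem_singleton, mem_skewCells_iff_colLen]
    constructor <;> rintro ⟨h, rfl⟩ <;> exact ⟨h, rfl⟩
  rw [colSize, h, card_product, Nat.card_Ico, card_singleton, mul_one]

theorem mem_rowLens {kap : YoungDiagram} {x : ℕ} :
    x ∈ kap.rowLens ↔ ∃ i < kap.colLen 0, kap.rowLen i = x := by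
  simp [YoungDiagram.rowLens]

theorem IsRectangle.rowLen_eq {kap : YoungDiagram} (h : IsRectangle kap) {i : ℕ}
    (hi : i < kap.colLen 0) : kap.rowLen i = kap.rowLen 0 := by
  obtain ⟨x, hx⟩ := card_eq_one.1 h
  have hmem : ∀ i < kap.colLen 0, kap.rowLen i = x := fun i hi => by
    rw [← mem_singleton, ← hx, List.mem_toFinset, mem_rowLens]
    exact ⟨i, hi, rfl⟩
  rw [hmem i hi, hmem 0 (by omega)]

theorem exists_rowLen_lt {kap : YoungDiagram} (hne : kap ≠ ⊥) (hrect : ¬ IsRectangle kap) :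
    ∃ i < kap.colLen 0, kap.rowLen i < kap.rowLen 0 := by
  by_contra! hcon
  have hpos : 0 < kap.colLen 0 := by
    by_contra h0
    refine hne (eq_of_rowLen_eq fun i => ?_)
    rw [rowLen_eq_zero (by omega), rowLen_bot]
  refine hrect (card_eq_one.2 ⟨kap.rowLen 0, ?_⟩)
  ext x
  rw [List.mem_toFinset, mem_rowLens, mem_singleton]
  constructor
  · rintro ⟨i, hi, rfl⟩
    exact le_antisymm (kap.rowLen_anti 0 i (Nat.zero_le i)) (hcon i hi)
  · rintro rfl
    exact ⟨0, hpos, rfl⟩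

/-- Take the column whose index is a part smaller than the largest one: it meets row `0` but not the
row of that part. -/
theorem exists_colLen_between (hne : mu ≠ ⊥) (hrect : ¬ IsRectangle mu) :
    ∃ l < mu.rowLen 0, 0 < mu.colLen l ∧ mu.colLen l < mu.colLen 0 := by
  obtain ⟨i, hi, hlt⟩ := exists_rowLen_lt hne hrect
  refine ⟨mu.rowLen i, hlt, ?_, lt_of_le_of_lt ?_ hi⟩
  · exact YoungDiagram.mem_iff_lt_colLen.1 (YoungDiagram.mem_iff_lt_rowLen.2 hlt)
  · rw [← not_lt, ← YoungDiagram.mem_iff_lt_colLen, YoungDiagram.mem_iff_lt_rowLen]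
    exact lt_irrefl _

theorem mem_dual {i j : ℕ} : (i, j) ∈ dual lam ↔
    (i < lam.colLen 0 ∧ j < lam.rowLen 0) ∧
      (lam.colLen 0 - 1 - i, lam.rowLen 0 - 1 - j) ∉ lam := by
  rw [dual, compl, ← YoungDiagram.mem_cells, mem_filter, mem_product, mem_range, mem_range]

theorem exists_colLen_between_of_dual (hne : dual lam ≠ ⊥) (hrect : ¬ IsRectangle (dual lam)) :
    ∃ l < lam.rowLen 0, lam.colLen (lam.rowLen 0 - 1) < lam.colLen l ∧
      lam.colLen l < lam.colLen 0 := by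
  obtain ⟨j, hj, hpos, hlt⟩ := exists_colLen_between hne hrect
  have h1 : (0, j) ∈ dual lam := YoungDiagram.mem_iff_lt_rowLen.2 hj
  have h2 : ((dual lam).colLen j, j) ∉ dual lam := by
    rw [YoungDiagram.mem_iff_lt_colLen]
    exact lt_irrefl _
  have h3 : ((dual lam).colLen j, 0) ∈ dual lam := YoungDiagram.mem_iff_lt_colLen.2 hlt
  generalize (dual lam).colLen j = i at *
  rw [mem_dual] at h1 h2 h3
  simp only [YoungDiagram.mem_iff_lt_colLen, Nat.sub_zero] at h1 h2 h3
  exact ⟨lam.rowLen 0 - 1 - j, by omega, by omega, by omega⟩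

theorem colLen_le_firstMult (hpos : 0 < lam.rowLen 0) :
    lam.colLen (lam.rowLen 0 - 1) ≤ firstMult lam := by
  have hle : lam.colLen (lam.rowLen 0 - 1) ≤ lam.rowLens.length := by
    rw [YoungDiagram.length_rowLens]
    exact lam.colLen_anti 0 _ (Nat.zero_le _)
  have hcount : (lam.rowLens.take (lam.colLen (lam.rowLen 0 - 1))).count (lam.rowLen 0) =
      (lam.rowLens.take (lam.colLen (lam.rowLen 0 - 1))).length := by
    refine List.count_eq_length.2 fun x hx => ?_
    obtain ⟨i, hi, rfl⟩ := List.mem_take_iff_getElem.1 hx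
    rw [YoungDiagram.get_rowLens]
    have h1 : (i, lam.rowLen 0 - 1) ∈ lam :=
      YoungDiagram.mem_iff_lt_colLen.2 (lt_of_lt_of_le hi (min_le_left _ _))
    rw [YoungDiagram.mem_iff_lt_rowLen] at h1
    have := lam.rowLen_anti 0 i (Nat.zero_le i)
    omega
  rw [List.length_take_of_le hle] at hcount
  rw [← hcount]
  exact (List.take_sublist _ _).count_le _

theorem isSharp_iff : IsSharp n lam mu ↔ rho lam mu < n := by
  have hzero : ∀ k, lam.rowLen 0 ≤ k → colSize lam mu k = 0 := fun k hk => by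
    have : ¬ 0 < lam.colLen k := by
      rw [← YoungDiagram.mem_iff_lt_colLen, YoungDiagram.mem_iff_lt_rowLen]
      omega
    rw [colSize_eq]
    omega
  constructor
  · intro h
    exact (Finset.sup_lt_iff ((Nat.zero_le _).trans_lt (h 0))).2 fun k _ => h k
  · intro h k
    by_cases hk : k < lam.rowLen 0
    · exact (le_sup (f := colSize lam mu) (mem_range.2 hk)).trans_lt h
    · rw [hzero k (by omega)]
      omega

theorem not_isMultiplicityFree_of_isTight (hsub : mu ≤ lam) (hsharp : IsSharp n lam mu)
    (htight : IsTight lam mu) (hlam_ne : dual lam ≠ ⊥) (hlam : ¬ IsRectangle (dual lam))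
    (hmu_ne : mu ≠ ⊥) (hmu : ¬ IsRectangle mu) : ¬ IsMultiplicityFree n lam mu := by
  obtain ⟨⟨hrow, hcol⟩, htau, hsigma⟩ := htight
  have hlt : ∀ j < lam.rowLen 0, mu.colLen j < lam.colLen j := fun j hj => by
    obtain ⟨i, hi⟩ := hcol j hj
    have := mem_skewCells_iff_colLen.1 hi
    omega
  have hn : ∀ j < lam.rowLen 0, lam.colLen j - mu.colLen j < n := fun j _ => by
    rw [← colSize_eq]
    exact hsharp j
  obtain ⟨p, hp, hp0, hp1⟩ := exists_colLen_between hmu_ne hmu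
  obtain ⟨q, hq, hq0, hq1⟩ := exists_colLen_between_of_dual hlam_ne hlam
  have hW : 0 < lam.rowLen 0 := by omega
  have hpW : p < lam.rowLen 0 := hp.trans_le (rowLen_mono hsub 0)
  have hnrect : ¬ IsRectangle lam := fun hrect => by
    have h1 := hrect.rowLen_eq hq1
    have h2 : (lam.colLen q, q) ∉ lam := by
      rw [YoungDiagram.mem_iff_lt_colLen]
      exact lt_irrefl _
    rw [YoungDiagram.mem_iff_lt_rowLen] at h2
    omega
  rw [tau, if_neg (not_or.2 ⟨hmu_ne, hnrect⟩)] at htau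
  rw [sigma, if_neg (not_or.2 ⟨hmu_ne, hnrect⟩)] at hsigma
  -- This is `τ = 0`: the last column of `λ` does not reach below `μ`.
  have hlast_le : lam.colLen (lam.rowLen 0 - 1) ≤ mu.colLen 0 := by
    have := colLen_le_firstMult hW
    omega
  -- This is `σ = 0`: a column that reaches the last row of `λ` lies over a box of `μ`.
  have htop : ∀ j, lam.colLen j = lam.colLen 0 → 0 < mu.colLen j := fun j hj => by
    have h1 : (lam.colLen 0 - 1, j) ∈ lam := YoungDiagram.mem_iff_lt_colLen.2 (by omega)
    rw [YoungDiagram.mem_iff_lt_rowLen] at h1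
    rw [lastPart] at hsigma
    rw [← YoungDiagram.mem_iff_lt_colLen, YoungDiagram.mem_iff_lt_rowLen]
    omega
  have hlast : mu.colLen (lam.rowLen 0 - 1) = 0 := by
    obtain ⟨j, hj⟩ := hrow 0 (by omega)
    rw [mem_skewCells] at hj
    by_contra hcon
    have h1 : (0, lam.rowLen 0 - 1) ∈ mu := YoungDiagram.mem_iff_lt_colLen.2 (by omega)
    rw [YoungDiagram.mem_iff_lt_rowLen] at h1
    omega
  have hrows : ∀ i < lam.colLen 0, ∃ j, mu.colLen j ≤ i ∧ i < lam.colLen j := fun i hi => by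
    obtain ⟨j, hj⟩ := hrow i hi
    exact ⟨j, mem_skewCells_iff_colLen.1 hj⟩
  have ht : ∀ i j, i ≤ j → mu.colLen j ≤ mu.colLen i := mu.colLen_anti
  have hb : ∀ i j, i ≤ j → lam.colLen j ≤ lam.colLen i := lam.colLen_anti
  set w := lam.rowLen 0 - 1 with hw
  -- The last column qualifies; `j` becomes the first column with both ends strictly above those of
  -- column `0`.
  have hex : ∃ j, mu.colLen j < mu.colLen 0 ∧ lam.colLen j < lam.colLen 0 :=
    ⟨w, by omega, by omega⟩
  classical
  obtain ⟨hj1, hj2⟩ := Nat.find_spec hex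
  have hmin := fun i => Nat.find_min (H := hex) (m := i)
  have hjw : Nat.find hex ≤ w := Nat.find_le ⟨by omega, by omega⟩
  have hj0 : 0 < Nat.find hex := by
    by_contra h0
    rw [Nat.eq_zero_of_not_pos h0] at hj1
    omega
  generalize Nat.find hex = j at *
  -- If `j` ends like the last column, then `q < j` has the top of column `0` by minimality, and `j
  -- ≤ p`: the columns `0, q, p, w` fit.
  by_cases hbj : lam.colLen j = lam.colLen w
  · have hqj : q < j := by
      by_contra hcon
      have := hb j q (by omega)
      omega
    have htq := hmin q hqj
    have htq' := ht 0 q (Nat.zero_le q)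
    have hpj : j ≤ p := by
      by_contra hcon
      have h1 := hmin p (by omega)
      have h2 := hb 0 p (Nat.zero_le p)
      have h3 := ht q p
      have h4 := ht p q
      have h5 := hb q p
      omega
    have hbp := hb j p hpj
    have hpw : p < w := by
      by_contra hcon
      have := ht w p (by omega)
      omega
    have hbw := hb p w hpw.le
    have hq00 : 0 < q := by
      rcases Nat.eq_zero_or_pos q with h | h
      · rw [h] at hq1
        omega
      · exact h
    exact not_isMultiplicityFree_of_straight_rotated hsub hlt hn hq00 (hqj.trans_le hpj) hpw
      (by omega) (by omega) hp0 hlast hq1 (by omega) hlast_le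
  · have hbw := hb j w hjw
    have hjw' : j < w := by
      refine lt_of_le_of_ne hjw fun h => hbj (by rw [h])
    by_cases htj : mu.colLen j = 0
    · have hpj : p < j := by
        by_contra hcon
        have := ht j p (by omega)
        omega
      have hpj' := ht p (j - 1) (by omega)
      have hmin' := hmin (j - 1) (by omega)
      have hb' := hb 0 (j - 1) (Nat.zero_le _)
      have hbj' : lam.colLen (j - 1) = lam.colLen 0 := by omega
      have hpos := htop _ hbj'
      have hj1' : 0 < j - 1 := by
        rcases Nat.eq_zero_or_pos (j - 1) with h | h
        · rw [h] at hpj'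
          omega
        · exact h
      -- Otherwise the row just above column `j - 1` would be empty.
      have htb : mu.colLen (j - 1) ≤ lam.colLen j := by
        by_contra hcon
        have h1 := hlt (j - 1) (by omega)
        obtain ⟨c, hc1, hc2⟩ := hrows (mu.colLen (j - 1) - 1) (by omega)
        obtain h2 | h2 := le_or_gt j c
        · have := hb j c h2
          omega
        · have := ht c (j - 1) (by omega)
          omega
      exact not_isMultiplicityFree_of_rotated_straight hsub hlt hn hj1' (by omega : j - 1 < j) hjw'
        (by omega) (by omega) hpos htj hlast hbj'.symm (by omega) (by omega) htb
    · exact not_isMultiplicityFree_of_steps hsub hlt hn hj0 hjw' (by omega) hj1 (by omega) hj2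
        (by omega)

end Hypotheses

end SkewSchur

end

theorem theorem3p3 (lam mu : YoungDiagram) (hsub : mu ≤ lam) (n : ℕ)
    (hbasic : SkewSchur.IsBasic lam mu) (hsharp : SkewSchur.IsSharp n lam mu)
    (htight : SkewSchur.IsTight lam mu)
    (hlam_ne : SkewSchur.dual lam ≠ ⊥) (hlam : ¬ SkewSchur.IsRectangle (SkewSchur.dual lam))
    (hmu_ne : mu ≠ ⊥) (hmu : ¬ SkewSchur.IsRectangle mu) :
    ¬ SkewSchur.IsMultiplicityFree n lam mu ∧
      IsLeast {m : ℕ | SkewSchur.IsSharp m lam mu ∧ ¬ SkewSchur.IsMultiplicityFree m lam mu}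
        (SkewSchur.rho lam mu + 1) := by
  have key : ∀ m, SkewSchur.IsSharp m lam mu → ¬ SkewSchur.IsMultiplicityFree m lam mu :=
    fun m hm => SkewSchur.not_isMultiplicityFree_of_isTight hsub hm htight hlam_ne hlam hmu_ne hmu
  have hrho : SkewSchur.IsSharp (SkewSchur.rho lam mu + 1) lam mu :=
    SkewSchur.isSharp_iff.2 (Nat.lt_succ_self _)
  exact ⟨key n hsharp, ⟨hrho, key _ hrho⟩, fun m hm => SkewSchur.isSharp_iff.1 hm.1⟩
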